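/- **Theorem 2.2.** A *diffeological space* is a set $X$ with a family of maps ("plots") $\mathbb R^n\to X$ ($n\ge 0$) — equivalently, from open subsets of $\mathbb R^n$ — containing the constant maps, closed under smooth reparametrisation, and local; a map is *smooth* if it sends plots to plots. The *D-topology* is the finest topology making all plots continuous; maps are called continuous if they are continuous for the D-topologies. A smooth manifold carries the diffeology of all ordinary smooth maps (its D-topology is the manifold topology); subsets and products carry the subset and product diffeologies. A *smooth CW complex* is a diffeological space $X$ that is the colimit, in the category of diffeological spaces and smooth maps, of a sequence of skeleta $X_0\to X_1\to X_2\to\cdots$, where $X_0$ is a set with the discrete diffeology, and for each $n\ge 0$ there is a smooth map $h_n:\coprod_\alpha S^n_\alpha\to X_n$ such that $X_{n+1}=X_n\cup_{h_n}\coprod_\alpha D^{n+1}_\alpha$ is the pushout of $h_n$ and the inclusion $\coprod_\alpha S^n_\alpha\hookrightarrow\coprod_\alpha D^{n+1}_\alpha$ (the unit sphere and closed unit disk having the subset diffeology from $\mathbb R^{n+1}$). It is *finite-dimensional* if it has no cells of dimension greater than some $N$. A *continuous homotopy* from $f:M\to X$ to $g:M\to X$ is a continuous map $H:M\times\mathbb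 R\to X$ such that for some $0<\varepsilon<\tfrac12$ one has $H(x,t)=f(x)$ for $t\le\varepsilon$ and $H(x,t)=g(x)$ for $t\ge 1-\varepsilon$; it is *relative to* $A\subset M$ if $H(x,t)=f(x)$ for all $x\in A$, $t\in\mathbb R$. Let $M$ be a smooth manifold (Hausdorff, paracompact, without boundary, of some finite dimension $d$), let $X$ be a smooth CW complex, and let $f:M\to X$ be a continuous map. 1. There exist a smooth map $g:M\to X$ and a continuous homotopy from $f$ to $g$. 2. If $A\subset M$ is closed, $f$ is smooth on $A$ (that is, the restriction of $f$ to some open set $B\supset A$ is smooth), and either $M$ is compact or $X$ is finite-dimensional, then there exist a smooth map $g:M\to X$ and a continuous homotopy from $f$ to $g$ relative to $A$. -/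

import Mathlib

open Set Topology Diffeology
open scoped Manifold ContDiff

noncomputable section

namespace WhitneyCW

/-! ### Diffeologies on subsets, products, disjoint unions and manifolds -/

/-- The subset diffeology: a map into `s` is a plot iff it is a plot of the ambient space. -/
instance subsetDiffeology {X : Type*} [DiffeologicalSpace X] (s : Set X) :
    DiffeologicalSpace s where
  plots n := {p | IsPlot (fun x => (p x : X))}
  constant_plots _ := isPlot_const
  plot_reparam hp hf := isPlot_reparam hp hf
  locality h := DiffeologicalSpace.locality h

/-- The product diffeology: a map is a plot iff both components are plots. -/
instance prodDiffeology {X Y : Type*} [DiffeologicalSpace X] [DiffeologicalSpace Y] :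
    DiffeologicalSpace (X × Y) where
  plots n := {p | IsPlot (fun x => (p x).1) ∧ IsPlot (fun x => (p x).2)}
  constant_plots _ := ⟨isPlot_const, isPlot_const⟩
  plot_reparam hp hf := ⟨isPlot_reparam hp.1 hf, isPlot_reparam hp.2 hf⟩
  locality h := by
    refine ⟨DiffeologicalSpace.locality fun x => ?_, DiffeologicalSpace.locality fun x => ?_⟩
    · obtain ⟨u, hu, hx, hp⟩ := h x
      exact ⟨u, hu, hx, fun hf hf' => (hp hf hf').1⟩
    · obtain ⟨u, hu, hx, hp⟩ := h x
      exact ⟨u, hu, hx, fun hf hf' => (hp hf hf').2⟩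

/-- The disjoint union (coproduct) diffeology: the finest diffeology for which all the inclusions
of the summands are smooth. -/
instance sigmaDiffeology {ι : Type*} {Y : ι → Type*} [∀ i, DiffeologicalSpace (Y i)] :
    DiffeologicalSpace (Σ i, Y i) :=
  DiffeologicalSpace.generateFrom
    {P | ∃ (i : ι) (q : EuclideanSpace ℝ (Fin P.1) → Y i), IsPlot q ∧ P.2 = fun x => ⟨i, q x⟩}

/-- The standard diffeology of a smooth `d`-manifold (without boundary) `M`: the plots are the maps
`ℝⁿ → M` that are smooth in the usual sense. Its D-topology is by definition the given
topology of `M`; the last field proves that this is indeed the D-topology. -/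
@[reducible]
def manifoldDiffeology (d : ℕ) (M : Type*) [TopologicalSpace M]
    [ChartedSpace (EuclideanSpace ℝ (Fin d)) M] [IsManifold (𝓡 d) ∞ M] :
    DiffeologicalSpace M :=
  .ofCorePlotsOn {
    isPlotOn := fun {n u} _ p => ContMDiffOn (𝓡 n) (𝓡 d) ∞ p u
    isPlotOn_congr := fun _ _ _ h => contMDiffOn_congr h
    isPlot := fun {n} p => ContMDiff (𝓡 n) (𝓡 d) ∞ p
    isPlotOn_univ := contMDiffOn_univ
    isPlot_const := fun _ => contMDiff_const
    isPlotOn_reparam := fun _ _ _ h hp hf => hp.comp hf.contMDiffOn h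
    locality := fun _ _ h x hx => by
      obtain ⟨v, hv, hxv, hp⟩ := h x hx
      exact ((hp x hxv).contMDiffAt (hv.mem_nhds hxv)).contMDiffWithinAt
    dTopology := ‹TopologicalSpace M›
    isOpen_iff_preimages_plots := fun {u} => by
      refine ⟨fun hu _ _ hp => IsOpen.preimage hp.continuous hu, fun h => ?_⟩
      refine isOpen_iff_mem_nhds.2 fun x hx => ?_
      -- a smooth parametrisation, by all of `ℝᵈ`, of a ball in the chart at `x`
      let φ := chartAt (EuclideanSpace ℝ (Fin d)) x
      obtain ⟨ε, hε, hball⟩ := Metric.isOpen_iff.1 φ.open_target _ (mem_chart_target _ x)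
      let b := OpenPartialHomeomorph.univBall (φ x) ε
      have hmap : ∀ y, b y ∈ φ.target := fun y => hball <| by
        have := b.map_source (x := y) (by simp [b])
        rwa [OpenPartialHomeomorph.univBall_target _ hε] at this
      have hp : ContMDiff (𝓡 d) (𝓡 d) ∞ (φ.symm ∘ b) :=
        ContMDiffOn.comp_contMDiff (contMDiffOn_chart_symm (I := 𝓡 d) (n := ∞) (x := x))
          (OpenPartialHomeomorph.contDiff_univBall (n := ⊤)).contMDiff hmap
      have hb0 : b 0 = φ x := OpenPartialHomeomorph.univBall_apply_zero _ _
      have h1 := h _ hp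
      have h2 : IsOpen (b '' ((φ.symm ∘ b) ⁻¹' u)) :=
        b.isOpen_image_of_subset_source h1 (by simp [b])
      have h3 : IsOpen (φ.symm '' (b '' ((φ.symm ∘ b) ⁻¹' u))) :=
        φ.symm.isOpen_image_of_subset_source h2 (by
          rintro _ ⟨y, -, rfl⟩; exact hmap y)
      refine Filter.mem_of_superset (h3.mem_nhds ?_) ?_
      · refine ⟨φ x, ⟨0, ?_, hb0⟩, φ.left_inv (mem_chart_source _ x)⟩
        simpa [hb0, φ] using hx
      · rintro _ ⟨_, ⟨y, hy, rfl⟩, rfl⟩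
        exact hy }

/-! ### Smooth CW complexes -/

/-- The unit sphere `Sⁿ ⊆ ℝⁿ⁺¹`. -/
abbrev Sph (n : ℕ) : Type := Metric.sphere (0 : EuclideanSpace ℝ (Fin (n + 1))) 1

/-- The closed unit disk `Dⁿ⁺¹ ⊆ ℝⁿ⁺¹`. -/
abbrev Disk (n : ℕ) : Type := Metric.closedBall (0 : EuclideanSpace ℝ (Fin (n + 1))) 1

/-- The inclusion of a disjoint union of `n`-spheres into the disjoint union of the corresponding
`(n+1)`-disks. -/
def sphIncl (n : ℕ) (ι : Type*) (s : Σ _ : ι, Sph n) : Σ _ : ι, Disk n :=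
  ⟨s.1, ⟨s.2.1, Metric.sphere_subset_closedBall s.2.2⟩⟩

universe u

/-- `i : L → P`, `j : D → P` exhibit `P` as the pushout of `h : S → L` and `k : S → D` in the
category of diffeological spaces and smooth maps. -/
structure IsSmoothPushout {S L D P : Type u} [DiffeologicalSpace S] [DiffeologicalSpace L]
    [DiffeologicalSpace D] [DiffeologicalSpace P]
    (h : S → L) (k : S → D) (i : L → P) (j : D → P) : Prop where
  smooth_left : DSmooth i
  smooth_right : DSmooth j
  comm : i ∘ h = j ∘ k
  existsUnique_desc : ∀ (Z : Type u) [DiffeologicalSpace Z] (a : L → Z) (b : D → Z),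
    DSmooth a → DSmooth b → a ∘ h = b ∘ k →
      ∃! c : P → Z, DSmooth c ∧ c ∘ i = a ∧ c ∘ j = b

/-- The maps `ι n : Y n → X` exhibit `X` as the colimit of the sequence `Y 0 → Y 1 → ⋯` in the
category of diffeological spaces and smooth maps. -/
structure IsSmoothSeqColimit {Y : ℕ → Type u} [∀ n, DiffeologicalSpace (Y n)]
    {X : Type u} [DiffeologicalSpace X]
    (s : ∀ n, Y n → Y (n + 1)) (ι : ∀ n, Y n → X) : Prop where
  smooth : ∀ n, DSmooth (ι n)
  comm : ∀ n, ι (n + 1) ∘ s n = ι n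
  existsUnique_desc : ∀ (Z : Type u) [DiffeologicalSpace Z] (a : ∀ n, Y n → Z),
    (∀ n, DSmooth (a n)) → (∀ n, a (n + 1) ∘ s n = a n) →
      ∃! c : X → Z, DSmooth c ∧ ∀ n, c ∘ ι n = a n

/-- The structure of a smooth CW complex on a diffeological space `X`: `X` is the colimit of
skeleta `X₀ → X₁ → ⋯`, where `X₀` is discrete and `Xₙ₊₁` is obtained from `Xₙ` by attaching
`(n+1)`-disks along a smooth map defined on the disjoint union of their boundary spheres. -/
structure SmoothCWStructure (X : Type u) [DiffeologicalSpace X] where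
  /-- The `n`-skeleton. -/
  skel : ℕ → Type u
  /-- The diffeology of the `n`-skeleton. -/
  [skelDiffeology : ∀ n, DiffeologicalSpace (skel n)]
  /-- The `0`-skeleton is discrete (`⊥` is the finest diffeology). -/
  skel_zero_discrete : skelDiffeology 0 = ⊥
  /-- The index set of the `(n+1)`-cells. -/
  cell : ℕ → Type u
  /-- The attaching map of all the `(n+1)`-cells. -/
  attach : ∀ n, (Σ _ : cell n, Sph n) → skel n
  smooth_attach : ∀ n, DSmooth (attach n)
  /-- The inclusion of the `n`-skeleton into the `(n+1)`-skeleton. -/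
  skelIncl : ∀ n, skel n → skel (n + 1)
  /-- The characteristic map of all the `(n+1)`-cells. -/
  charMap : ∀ n, (Σ _ : cell n, Disk n) → skel (n + 1)
  isPushout : ∀ n, IsSmoothPushout (attach n) (sphIncl n (cell n)) (skelIncl n) (charMap n)
  /-- The inclusion of the `n`-skeleton into `X`. -/
  incl : ∀ n, skel n → X
  isColimit : IsSmoothSeqColimit skelIncl incl

/-- A smooth CW complex is finite-dimensional if it has no cells in dimensions above some `N`. -/
def SmoothCWStructure.IsFiniteDimensional {X : Type u} [DiffeologicalSpace X]
    (K : SmoothCWStructure X) : Prop :=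
  ∃ N : ℕ, ∀ n, N ≤ n → IsEmpty (K.cell n)

/-! ### Continuous maps and homotopies, smoothness on a closed subset -/

section Maps

variable {Y Z : Type*} [DiffeologicalSpace Y] [DiffeologicalSpace Z]

/-- A map between diffeological spaces that is continuous for the D-topologies. -/
def DContinuous (f : Y → Z) : Prop := Continuous[dTopology, dTopology] f

/-- `H : Y × ℝ → Z` is a continuous homotopy from `f` to `g`: it is continuous for the D-topologies,
and stationary at `f` for `t ≤ ε` and at `g` for `t ≥ 1 - ε`, for some small `ε > 0`. -/
def IsContinuousHomotopy (H : Y × ℝ → Z) (f g : Y → Z) : Prop :=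
  DContinuous H ∧ ∃ ε : ℝ, 0 < ε ∧ ε < 1 / 2 ∧
    (∀ x t, t ≤ ε → H (x, t) = f x) ∧ (∀ x t, 1 - ε ≤ t → H (x, t) = g x)

/-- The homotopy `H` starting at `f` is relative to `A`. -/
def IsRelativeTo (H : Y × ℝ → Z) (f : Y → Z) (A : Set Y) : Prop :=
  ∀ x ∈ A, ∀ t, H (x, t) = f x

/-- `f` is smooth on `A` if it is smooth on some D-open set containing `A`. -/
def SmoothOnNhd (f : Y → Z) (A : Set Y) : Prop :=
  ∃ B : Set Y, IsOpen[dTopology] B ∧ A ⊆ B ∧ DSmooth (fun x : B => f x)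

end Maps

end WhitneyCW

end

open WhitneyCW

/-!
# Smooth approximation of continuous maps to smooth CW complexes

A continuous map `f : M → X` that is smooth near a closed set `A` is to be deformed, relative to
`A`, to a smooth map; the absolute statement is the case `A = ∅`. Call a diffeological space
`Approximable` if this is possible for all `σ`-compact manifolds `M` of the given dimension.

*Attaching cells.* Let `P` be obtained from `L` by attaching disks. The universal property
determines the underlying set of `P` and shows that plots of `P` locally lift to `L` or to a
single disk (`IsSmoothPushout.isCellExtension`). If `L` is approximable, then so is `P`
(`Approximable.of_isCellExtension`): a map to `P` is first made smooth over the balls of radius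
`3/4` in the cells, where it is a map to a vector space; then the collars `1/2 ≤ ‖x‖ ≤ 1` of the
cells are pushed to the boundary, by a deformation that is switched off near `A`. On the open set
`V` of the points away from `A` that are not mapped close to the centres of the cells, the new map
takes values in `L`, where the approximation property of `L` can be applied relative to a closed set
whose interior, together with `V`, covers `M`. It is essential that the smoothing over `V` is
relative, since its result has to be glued with the map on the complement of `V`.

*Passing to the colimit.* The stages of the colimit are closed in `X`, carry the subset diffeology,
and every compact subset of `X` lies in one of them. So `X` is approximable for maps from
relatively compact open sets. Two families of disjoint relatively compact open sets, lying between
consecutive odd and consecutive even levels of an exhaustion function, suffice to cover `M`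
(`IsSmoothSeqColimit.approximable`).

*Paracompact manifolds.* The components of a paracompact manifold are open and `σ`-compact, and can
be treated separately. Homotopies are parametrised by the unit interval throughout, so that they can
be glued, and only the final homotopy is made stationary near its ends.
-/

open Filter

noncomputable section

namespace WhitneyCW

universe u v w

/-! ### Local criteria for plots -/

/-- The Euclidean space `ℝᵏ`, the domain of the `k`-dimensional plots. -/
abbrev Euc (k : ℕ) : Type := EuclideanSpace ℝ (Fin k)

/-- A smooth self-map of `ℝᵏ` that is the identity near `x` and takes values in a prescribed
neighbourhood of `x`. Precomposing with it extends germs of plots to global plots. -/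
lemma exists_contDiff_eventuallyEq_id {k : ℕ} {x : Euc k} {u : Set (Euc k)} (hu : u ∈ 𝓝 x) :
    ∃ e : Euc k → Euc k, ContDiff ℝ ∞ e ∧ (∀ y, e y ∈ u) ∧ e =ᶠ[𝓝 x] id := by
  obtain ⟨ε, hε, hball⟩ := Metric.mem_nhds_iff.1 hu
  let b : ContDiffBump x := ⟨ε / 4, ε / 2, by positivity, by linarith⟩
  refine ⟨fun y => x + b y • (y - x), ?_, fun y => hball ?_, ?_⟩
  · exact contDiff_const.add (b.contDiff.smul (contDiff_id.sub contDiff_const))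
  · rw [Metric.mem_ball, dist_eq_norm, add_sub_cancel_left, norm_smul, Real.norm_eq_abs,
      abs_of_nonneg b.nonneg]
    by_cases hy : dist y x < ε / 2
    · calc b y * ‖y - x‖ ≤ 1 * ‖y - x‖ := by gcongr; exact b.le_one
        _ < ε := by rw [one_mul, ← dist_eq_norm]; linarith
    · rw [b.zero_of_le_dist (not_lt.1 hy), zero_mul]; exact hε
  · filter_upwards [b.eventuallyEq_one] with y hy
    simp [hy]

section Plots

variable {X Y : Type*} [DiffeologicalSpace X] [DiffeologicalSpace Y]

lemma isPlot_of_eventuallyEq {k : ℕ} {p : Euc k → X}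
    (h : ∀ x, ∃ q : Euc k → X, IsPlot q ∧ p =ᶠ[𝓝 x] q) : IsPlot p := by
  refine DiffeologicalSpace.locality fun x => ?_
  obtain ⟨q, hq, hpq⟩ := h x
  obtain ⟨u, hu, hou, hxu⟩ := eventually_nhds_iff.1 hpq
  refine ⟨u, hou, hxu, fun {m f} hf hf' => ?_⟩
  have : p ∘ f = q ∘ f := funext fun y => hu _ (hf y)
  rw [this]
  exact isPlot_reparam hq hf'

lemma isPlot_of_forall_nhds {k : ℕ} {p : Euc k → X}
    (h : ∀ x, ∃ u ∈ 𝓝 x, ∀ e : Euc k → Euc k, ContDiff ℝ ∞ e → (∀ y, e y ∈ u) →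
      IsPlot (p ∘ e)) : IsPlot p := by
  refine isPlot_of_eventuallyEq fun x => ?_
  obtain ⟨u, hu, hp⟩ := h x
  obtain ⟨e, he, heu, hex⟩ := exists_contDiff_eventuallyEq_id hu
  exact ⟨p ∘ e, hp e he heu, hex.mono fun y hy => by simp [hy]⟩

lemma dSmooth_subtype_val {s : Set X} : DSmooth (Subtype.val : s → X) := fun _ _ hp => hp

lemma isPlot_subtype_iff {s : Set X} {k : ℕ} {p : Euc k → s} :
    IsPlot p ↔ IsPlot (fun x => (p x : X)) := Iff.rfl

lemma isPlot_sigma_mk {ι : Type*} {D : ι → Type*} [∀ i, DiffeologicalSpace (D i)] {k : ℕ}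
    (i : ι) {q : Euc k → D i} (hq : IsPlot q) : IsPlot (fun x => (⟨i, q x⟩ : Σ i, D i)) :=
  DiffeologicalSpace.isPlot_generatedFrom_of_mem ⟨i, q, hq, rfl⟩

lemma dSmooth_sigma_iff {ι : Type*} {D : ι → Type*} [∀ i, DiffeologicalSpace (D i)]
    {f : (Σ i, D i) → X} : DSmooth f ↔ ∀ i, DSmooth (fun y => f ⟨i, y⟩) := by
  refine ⟨fun h i n q hq => h n _ (isPlot_sigma_mk i hq), fun h n p hp => ?_⟩
  let d : DiffeologicalSpace (Σ i, D i) :=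
    { plots := fun n => {p | IsPlot (f ∘ p)}
      constant_plots := fun _ => isPlot_const
      plot_reparam := fun hp hf => isPlot_reparam hp hf
      locality := fun h => DiffeologicalSpace.locality h }
  exact hp d (by
    rintro ⟨m, p⟩ ⟨i, q, hq, hpq⟩
    have hp' : f ∘ p = fun x => f ⟨i, q x⟩ := by rw [show p = _ from hpq]; rfl
    change IsPlot (f ∘ p)
    rw [hp']
    exact h i m q hq)

lemma continuous_of_isPlot [TopologicalSpace X] [IsDTopologyCompatible X] {k : ℕ}
    {p : Euc k → X} (hp : IsPlot p) : Continuous p := by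
  have := hp.continuous
  rwa [IsDTopologyCompatible.dTop_eq X] at this

lemma isOpen_iff_plots [TopologicalSpace X] [IsDTopologyCompatible X] {u : Set X} :
    IsOpen u ↔ ∀ (k : ℕ) (p : Euc k → X), IsPlot p → IsOpen (p ⁻¹' u) := by
  rw [← isOpen_iff_preimages_plots, IsDTopologyCompatible.dTop_eq X]

end Plots

/-! ### Smoothness at a point of a map from a manifold to a diffeological space -/

section SmoothAt

variable (d : ℕ) {M : Type*} [TopologicalSpace M] [ChartedSpace (EuclideanSpace ℝ (Fin d)) M]
  {X Y : Type*} [DiffeologicalSpace X] [DiffeologicalSpace Y]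

/-- A map `f` from a `d`-manifold to a diffeological space is smooth at `m` if on some open
neighbourhood of `m` it sends smooth maps `ℝᵏ → M` to plots. -/
def DSmoothAt (f : M → X) (m : M) : Prop :=
  ∃ U : Set M, IsOpen U ∧ m ∈ U ∧ ∀ (k : ℕ) (p : Euc k → M), ContMDiff (𝓡 k) (𝓡 d) ∞ p →
    (∀ x, p x ∈ U) → IsPlot (f ∘ p)

variable {d} {f g : M → X} {m : M}

lemma DSmoothAt.congr (hf : DSmoothAt d f m) (h : f =ᶠ[𝓝 m] g) : DSmoothAt d g m := by
  obtain ⟨U, hU, hm, hp⟩ := hf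
  obtain ⟨V, hV, hoV, hmV⟩ := eventually_nhds_iff.1 h
  refine ⟨U ∩ V, hU.inter hoV, ⟨hm, hmV⟩, fun k p hps hpU => ?_⟩
  have : g ∘ p = f ∘ p := funext fun x => (hV _ (hpU x).2).symm
  rw [this]
  exact hp k p hps fun x => (hpU x).1

lemma DSmoothAt.isPlot_comp {k : ℕ} {p : Euc k → M} (hp : ContMDiff (𝓡 k) (𝓡 d) ∞ p)
    (h : ∀ x, DSmoothAt d f (p x)) : IsPlot (f ∘ p) := by
  refine isPlot_of_forall_nhds fun x => ?_
  obtain ⟨U, hU, hm, hfU⟩ := h x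
  refine ⟨p ⁻¹' U, (hU.preimage hp.continuous).mem_nhds hm, fun e he heu => ?_⟩
  exact hfU k (p ∘ e) (hp.comp he.contMDiff) heu

lemma dSmoothAt_of_isOpen {U : Set M} (hU : IsOpen U) (hm : m ∈ U)
    (h : ∀ (k : ℕ) (p : Euc k → M), ContMDiff (𝓡 k) (𝓡 d) ∞ p →
      (∀ x, p x ∈ U) → IsPlot (f ∘ p)) : DSmoothAt d f m := ⟨U, hU, hm, h⟩

lemma DSmoothAt.dSmooth_comp {φ : X → Y} (hf : DSmoothAt d f m) (hφ : DSmooth φ) :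
    DSmoothAt d (fun x => φ (f x)) m := by
  obtain ⟨U, hU, hm, hp⟩ := hf
  exact ⟨U, hU, hm, fun k p hps hpU => hφ _ _ (hp k p hps hpU)⟩

lemma DSmoothAt.prodMk {h : M → Y} (hf : DSmoothAt d f m) (hh : DSmoothAt d h m) :
    DSmoothAt d (fun x => (f x, h x)) m := by
  obtain ⟨U, hU, hm, hp⟩ := hf
  obtain ⟨V, hV, hmV, hq⟩ := hh
  exact ⟨U ∩ V, hU.inter hV, ⟨hm, hmV⟩, fun k p hps hpU =>
    ⟨hp k p hps fun x => (hpU x).1, hq k p hps fun x => (hpU x).2⟩⟩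

lemma dSmoothAt_of_contMDiff {F : Type*} [NormedAddCommGroup F] [NormedSpace ℝ F]
    [DiffeologicalSpace F] [IsContDiffCompatible F] {f : M → F}
    (hf : ContMDiff (𝓡 d) 𝓘(ℝ, F) ∞ f) (m : M) : DSmoothAt d f m :=
  ⟨univ, isOpen_univ, mem_univ m, fun _ _ hp _ => (hf.comp hp).contDiff.isPlot⟩

/-- Maps into a vector space that are smooth in the diffeological sense are smooth in the sense of
manifolds: test on the inverse of a chart, reparametrised by all of `ℝᵈ`. -/
lemma DSmoothAt.contMDiffAt [IsManifold (𝓡 d) ∞ M] {F : Type*} [NormedAddCommGroup F]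
    [NormedSpace ℝ F] [DiffeologicalSpace F] [IsContDiffCompatible F] {f : M → F} {m : M}
    (hf : DSmoothAt d f m) : ContMDiffAt (𝓡 d) 𝓘(ℝ, F) ∞ f m := by
  obtain ⟨U, hU, hm, hp⟩ := hf
  let φ := chartAt (EuclideanSpace ℝ (Fin d)) m
  have hV : φ.target ∩ φ.symm ⁻¹' U ∈ 𝓝 (φ m) :=
    (φ.symm.isOpen_inter_preimage hU).mem_nhds
      ⟨mem_chart_target _ m, by simpa [φ] using hm⟩
  obtain ⟨e, he, heV, hex⟩ := exists_contDiff_eventuallyEq_id hV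
  have hs : ContMDiff (𝓡 d) (𝓡 d) ∞ (φ.symm ∘ e) :=
    ContMDiffOn.comp_contMDiff (contMDiffOn_chart_symm (I := 𝓡 d) (n := ∞) (x := m))
      he.contMDiff fun y => (heV y).1
  have h1 : ContDiff ℝ ∞ (f ∘ φ.symm ∘ e) :=
    (hp d _ hs fun y => (heV y).2).contDiff
  have h2 : ContMDiffAt (𝓡 d) 𝓘(ℝ, F) ∞ ((f ∘ φ.symm ∘ e) ∘ φ) m :=
    h1.contMDiff.contMDiffAt.comp m
      ((contMDiffOn_chart (I := 𝓡 d) (n := ∞) (x := m)).contMDiffAt (chart_source_mem_nhds _ m))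
  refine h2.congr_of_eventuallyEq ?_
  have hc : ContinuousAt φ m := φ.continuousAt (mem_chart_source _ m)
  filter_upwards [hc.eventually hex, chart_source_mem_nhds (EuclideanSpace ℝ (Fin d)) m]
    with y hy hys
  simp only [Function.comp, hy, id]
  rw [φ.left_inv hys]

lemma DSmoothAt.restrict (V : TopologicalSpace.Opens M) {v : V} (hf : DSmoothAt d f v) :
    DSmoothAt d (fun x : V => f x) v := by
  obtain ⟨U, hU, hm, hp⟩ := hf
  exact ⟨Subtype.val ⁻¹' U, hU.preimage continuous_subtype_val, hm, fun k p hps hpU =>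
    hp k (fun x => p x) (contMDiff_subtype_val.comp hps) hpU⟩

lemma DSmoothAt.of_restrict (V : TopologicalSpace.Opens M) {v : V} {g : V → X}
    (hg : DSmoothAt d g v) (h : ∀ x : V, f x = g x) : DSmoothAt d f v := by
  obtain ⟨U, hU, hm, hp⟩ := hg
  refine ⟨Subtype.val '' U, V.isOpen.isOpenMap_subtype_val U hU, ⟨v, hm, rfl⟩,
    fun k p hps hpU => ?_⟩
  choose q hq hqp using hpU
  have : p = Subtype.val ∘ q := funext fun x => (hqp x).symm
  subst this
  have := hp k q ((ContMDiff.subtypeVal_comp_iff V q).1 hps) hq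
  convert this using 1
  exact funext fun x => h _

end SmoothAt

/-! ### Gluing homotopies and decomposing manifolds -/

section Topological

open scoped unitInterval

variable {M X : Type*} [TopologicalSpace M] [TopologicalSpace X]

/-- The restriction of a continuous map to an open subset. -/
def restrictOpens (f : C(M, X)) (V : TopologicalSpace.Opens M) : C(V, X) :=
  f.comp ⟨Subtype.val, continuous_subtype_val⟩

@[simp] lemma restrictOpens_apply (f : C(M, X)) (V : TopologicalSpace.Opens M) (x : V) :
    restrictOpens f V x = f x := rfl

/-- Homotopies `Hᵢ` relative to `S`, defined on disjoint open sets `Wᵢ` and starting at `f`, are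
glued to the homotopy `(t, m) ↦ Hᵢ (t * c m, m)`, where the function `c` cuts off the time.
It is continuously extended by `f` provided that near each point outside `⋃ Wᵢ` either the
cutoff vanishes or the homotopies are stationary. -/
theorem exists_homotopicRel_glue {ι : Type*} (f : C(M, X)) (W : ι → TopologicalSpace.Opens M)
    (hW : ∀ i j (m : M), m ∈ W i → m ∈ W j → i = j) (c : C(M, I)) (S : Set M)
    (g : ∀ i, C(W i, X))
    (H : ∀ i, (restrictOpens f (W i)).HomotopicRel (g i) (Subtype.val ⁻¹' S))
    (hS : ∀ m, (∀ i, m ∉ W i) → ∀ᶠ m' in 𝓝 m, c m' = 0 ∨ m' ∈ S) :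
    ∃ g' : C(M, X), f.HomotopicRel g' (S ∪ {m | c m = 0}) ∧
      ∀ i (x : W i), c x = 1 → g' x = g i x := by
  classical
  let F := fun i => (H i).some
  let K : I × M → X := fun p =>
    if h : ∃ i, p.2 ∈ W i then F h.choose (p.1 * c p.2, ⟨p.2, h.choose_spec⟩) else f p.2
  have hK : ∀ i (x : W i) (t : I), K (t, x) = F i (t * c x, x) := by
    intro i x t
    have h : ∃ i, (x : M) ∈ W i := ⟨i, x.2⟩
    have hi : h.choose = i := hW _ _ _ h.choose_spec x.2
    simp only [K, dif_pos h]
    clear_value F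
    have aux : ∀ j (hj : (x : M) ∈ W j), j = i →
        F j (t * c x, ⟨x, hj⟩) = F i (t * c x, x) := by
      rintro j hj rfl; rfl
    exact aux _ h.choose_spec hi
  have hK' : ∀ m t, (c m = 0 ∨ m ∈ S ∨ t = 0) → K (t, m) = f m := by
    intro m t hm
    by_cases h : ∃ i, m ∈ W i
    · obtain ⟨i, hi⟩ := h
      rw [hK i ⟨m, hi⟩ t]
      rcases hm with hm | hm | rfl
      · simp [hm]
      · exact (F i).eq_fst _ (x := ⟨m, hi⟩) hm
      · simp
    · simp only [K, dif_neg h]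
  have hcont : Continuous K := by
    rw [continuous_iff_continuousAt]
    rintro ⟨t, m⟩
    by_cases h : ∃ i, m ∈ W i
    · obtain ⟨i, hi⟩ := h
      have he : IsOpenEmbedding (Prod.map (id : I → I) (Subtype.val : W i → M)) :=
        IsOpenEmbedding.id.prodMap (W i).isOpen.isOpenEmbedding_subtypeVal
      have := he.continuousAt_iff (g := K) (x := (t, ⟨m, hi⟩))
      refine this.1 (Continuous.continuousAt ?_)
      have hKe : K ∘ Prod.map (id : I → I) (Subtype.val : W i → M) =
          fun p => F i (p.1 * c p.2, p.2) := by
        ext ⟨s, x⟩; exact hK i x s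
      rw [hKe]
      fun_prop
    · push Not at h
      have : ∀ᶠ p : I × M in 𝓝 (t, m), f p.2 = K p := by
        filter_upwards [continuous_snd.continuousAt.eventually (hS m h)] with p hp
        exact (hK' p.2 p.1 (hp.imp_right Or.inl)).symm
      exact ContinuousAt.congr (f.continuous.comp continuous_snd).continuousAt this
  refine ⟨⟨fun m => K (1, m), by fun_prop⟩, ⟨⟨⟨⟨K, hcont⟩, ?_, fun _ => rfl⟩, ?_⟩⟩, ?_⟩
  · exact fun m => hK' m 0 (Or.inr (Or.inr rfl))
  · intro t m hm
    exact hK' m t (hm.symm.imp id Or.inl)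
  · intro i x hx
    change K (1, x) = _
    rw [hK i x 1, hx]
    simp

/-- A `σ`-compact locally compact Hausdorff space carries a continuous exhaustion function. -/
theorem exists_continuous_exhaustion (M : Type*) [TopologicalSpace M] [T2Space M]
    [SigmaCompactSpace M] [LocallyCompactSpace M] :
    ∃ τ : C(M, ℝ), ∀ r, ∃ C : Set M, IsCompact C ∧ {m | τ m ≤ r} ⊆ C := by
  let K : CompactExhaustion M := default
  have hf : ∀ n, ∃ f : C(M, ℝ), EqOn f 0 (K n) ∧ EqOn f 1 (interior (K (n + 1)))ᶜ ∧
      ∀ x, f x ∈ Icc (0 : ℝ) 1 := fun n =>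
    exists_continuous_zero_one_of_isClosed (K.isCompact n).isClosed
      isOpen_interior.isClosed_compl
      (disjoint_compl_right_iff_subset.2 (K.subset_interior_succ n))
  choose f hf0 hf1 hf01 using hf
  have hlf : LocallyFinite fun n => Function.support (f n) := by
    intro x
    obtain ⟨N, hN⟩ := K.exists_mem_nhds x
    refine ⟨K N, hN, (finite_lt_nat N).subset ?_⟩
    rintro n ⟨y, hy, hyN⟩
    by_contra hn
    exact hy (hf0 n (K.subset (not_lt.1 hn) hyN))
  refine ⟨⟨fun x => ∑ᶠ n, f n x, continuous_finsum (fun n => (f n).continuous) hlf⟩, fun r => ?_⟩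
  obtain ⟨j, hj⟩ := exists_nat_gt r
  refine ⟨K j, K.isCompact j, fun x hx => ?_⟩
  by_contra hxj
  obtain ⟨N, hN⟩ := K.exists_mem x
  have hjN : j ≤ N := by
    by_contra h
    exact hxj (K.subset (not_le.1 h).le hN)
  have h1 : ∑ᶠ n, f n x = ∑ n ∈ Finset.range N, f n x := by
    refine finsum_eq_sum_of_support_subset _ fun n hn => ?_
    by_contra h
    exact hn (hf0 n (K.subset (by simpa using h) hN))
  have h2 : (j : ℝ) ≤ ∑ n ∈ Finset.range N, f n x := by
    calc (j : ℝ) = ∑ n ∈ Finset.range j, f n x := by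
          rw [Finset.sum_congr rfl (g := fun _ => (1 : ℝ))]
          · simp
          · intro n hn
            refine hf1 n fun h => hxj ?_
            exact K.subset (Finset.mem_range.1 hn) (interior_subset h)
      _ ≤ _ := Finset.sum_le_sum_of_subset_of_nonneg (Finset.range_mono hjN)
          fun n _ _ => (hf01 n x).1
  have h3 : ∑ᶠ n, f n x ≤ r := hx
  linarith

/-- The connected components of a paracompact locally compact Hausdorff space are `σ`-compact:
a point is contained in a clopen `σ`-compact set, obtained by repeatedly adding the finitely many
members of a locally finite relatively compact cover that meet the set built so far. -/
theorem isSigmaCompact_connectedComponent {M : Type*} [TopologicalSpace M] [T2Space M]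
    [ParacompactSpace M] [LocallyCompactSpace M] (x : M) :
    IsSigmaCompact (connectedComponent x) := by
  choose Q hQ hxQ using fun y : M => exists_compact_mem_nhds y
  obtain ⟨v, hvo, hvc, hvf, hvQ⟩ := precise_refinement (fun y => interior (Q y))
    (fun y => isOpen_interior)
    (eq_univ_of_forall fun y => mem_iUnion.2 ⟨y, mem_interior_iff_mem_nhds.2 (hxQ y)⟩)
  have hvcl : ∀ a, IsCompact (closure (v a)) := fun a =>
    (hQ a).of_isClosed_subset isClosed_closure
      (closure_minimal ((hvQ a).trans interior_subset) (hQ a).isClosed)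
  let step : Set M → Set M := fun C => ⋃ a ∈ {a | (v a ∩ C).Nonempty}, closure (v a)
  have hstep : ∀ C, IsCompact C → IsCompact (step C) := fun C hC =>
    (hvf.finite_nonempty_inter_compact hC).isCompact_biUnion fun a _ => hvcl a
  let C : ℕ → Set M := fun n => step^[n] {x}
  have hCs : ∀ n, C (n + 1) = step (C n) := fun n => Function.iterate_succ_apply' _ _ _
  have hC : ∀ n, IsCompact (C n) := by
    intro n
    induction n with
    | zero => exact isCompact_singleton
    | succ n ih => rw [hCs]; exact hstep _ ih
  have key : ∀ a n, (v a ∩ C n).Nonempty → v a ⊆ ⋃ n, C n := by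
    intro a n h
    refine subset_closure.trans (Subset.trans ?_ (subset_iUnion C (n + 1)))
    rw [hCs]
    exact subset_biUnion_of_mem (u := fun a => closure (v a)) h
  have hclopen : IsClopen (⋃ n, C n) := by
    refine ⟨⟨isOpen_iff_mem_nhds.2 fun y hy => ?_⟩, isOpen_iff_mem_nhds.2 fun y hy => ?_⟩
    all_goals
      obtain ⟨a, ha⟩ : ∃ a, y ∈ v a := by simpa using (hvc.symm ▸ mem_univ y : y ∈ ⋃ i, v i)
    · refine Filter.mem_of_superset ((hvo a).mem_nhds ha) fun z hz hzC => hy ?_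
      obtain ⟨n, hn⟩ := mem_iUnion.1 hzC
      exact key a n ⟨z, hz, hn⟩ ha
    · obtain ⟨n, hn⟩ := mem_iUnion.1 hy
      exact Filter.mem_of_superset ((hvo a).mem_nhds ha) (key a n ⟨y, ha, hn⟩)
  refine (isSigmaCompact_iUnion_of_isCompact C hC).of_isClosed_subset
    isClosed_connectedComponent (hclopen.connectedComponent_subset ?_)
  exact mem_iUnion.2 ⟨0, rfl⟩

end Topological

/-- A diffeological space `X` with its D-topology is approximable (in dimension `d`) if it satisfies
the relative smooth approximation property: a continuous map from a `σ`-compact `d`-manifold to `X`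
that is smooth on an open set `B` is homotopic to a smooth map, relative to any closed set
contained in `B`. -/
def Approximable (d : ℕ) (X : Type w) [TopologicalSpace X] [DiffeologicalSpace X] : Prop :=
  ∀ (M : Type v) [TopologicalSpace M] [T2Space M] [SigmaCompactSpace M]
    [ChartedSpace (EuclideanSpace ℝ (Fin d)) M] [IsManifold (𝓡 d) ∞ M] (f : C(M, X))
    (A B : Set M), IsClosed A → IsOpen B → A ⊆ B → (∀ m ∈ B, DSmoothAt d f m) →
    ∃ g : C(M, X), (∀ m, DSmoothAt d g m) ∧ f.HomotopicRel g A

/-- Smooth approximations on disjoint open sets are glued to a map that is smooth where the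
cutoff function is locally equal to `1`. -/
theorem exists_homotopicRel_smooth_glue {d : ℕ} {M : Type v} [TopologicalSpace M]
    [ChartedSpace (EuclideanSpace ℝ (Fin d)) M] {X ι : Type*} [TopologicalSpace X]
    [DiffeologicalSpace X] (f : C(M, X)) (W : ι → TopologicalSpace.Opens M)
    (hW : ∀ i j (m : M), m ∈ W i → m ∈ W j → i = j) (c : C(M, unitInterval)) (S : Set M)
    (hf : ∀ i, ∃ g : C(W i, X), (∀ m, DSmoothAt d g m) ∧
      (restrictOpens f (W i)).HomotopicRel g (Subtype.val ⁻¹' S))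
    (hS : ∀ m, (∀ i, m ∉ W i) → ∀ᶠ m' in 𝓝 m, c m' = 0 ∨ m' ∈ S) :
    ∃ g : C(M, X), f.HomotopicRel g (S ∪ {m | c m = 0}) ∧
      ∀ i, ∀ m ∈ W i, (∀ᶠ m' in 𝓝 m, c m' = 1) → DSmoothAt d g m := by
  choose g hg hgf using hf
  obtain ⟨g', hfg, hg'⟩ := exists_homotopicRel_glue f W hW c S g hgf hS
  refine ⟨g', hfg, fun i m hm hc => ?_⟩
  classical
  let g₀ : M → X := fun x => if hx : x ∈ W i then g i ⟨x, hx⟩ else f x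
  have h₀ : DSmoothAt d g₀ m :=
    DSmoothAt.of_restrict (W i) (v := ⟨m, hm⟩) (hg i ⟨m, hm⟩) fun x => dif_pos x.2
  refine h₀.congr ?_
  filter_upwards [hc, (W i).isOpen.mem_nhds hm] with x hx hxW
  rw [hg' i ⟨x, hxW⟩ hx]
  exact dif_pos hxW

lemma sigmaCompactSpace_opens (d : ℕ) {M : Type v} [TopologicalSpace M] [SigmaCompactSpace M]
    [ChartedSpace (EuclideanSpace ℝ (Fin d)) M] (V : TopologicalSpace.Opens M) :
    SigmaCompactSpace V := by
  have : SecondCountableTopology M :=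
    ChartedSpace.secondCountable_of_sigmaCompact (EuclideanSpace ℝ (Fin d)) M
  have : LocallyCompactSpace M := ChartedSpace.locallyCompactSpace (EuclideanSpace ℝ (Fin d)) M
  have : LocallyCompactSpace V := V.isOpen.locallyCompactSpace
  infer_instance

lemma normalSpace_of_chartedSpace (d : ℕ) (M : Type v) [TopologicalSpace M] [T2Space M]
    [SigmaCompactSpace M] [ChartedSpace (EuclideanSpace ℝ (Fin d)) M] : NormalSpace M := by
  have : LocallyCompactSpace M := ChartedSpace.locallyCompactSpace (EuclideanSpace ℝ (Fin d)) M
  infer_instance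

/-! ### The disk -/

section Disk

variable {n : ℕ}

/-- The smooth map `x ↦ 2x / (1 + ‖x‖²)` from `ℝⁿ⁺¹` onto the closed unit disk, folding along
the unit sphere. -/
def foldDisk (n : ℕ) (x : EuclideanSpace ℝ (Fin (n + 1))) : Disk n :=
  ⟨(2 / (1 + ‖x‖ ^ 2)) • x, by
    have h : 0 < 1 + ‖x‖ ^ 2 := by positivity
    rw [mem_closedBall_zero_iff, norm_smul, Real.norm_eq_abs, abs_of_pos (by positivity),
      div_mul_eq_mul_div, div_le_one h]
    nlinarith [sq_nonneg (‖x‖ - 1)]⟩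

lemma isPlot_foldDisk : IsPlot (foldDisk n) := by
  rw [isPlot_subtype_iff]
  have h : ContDiff ℝ ∞ fun x : EuclideanSpace ℝ (Fin (n + 1)) => (2 / (1 + ‖x‖ ^ 2)) • x :=
    (contDiff_const.div (contDiff_const.add (contDiff_norm_sq ℝ)) fun x => by positivity).smul
      contDiff_id
  exact h.isPlot

lemma continuous_disk_of_isPlot {k : ℕ} {q : Euc k → Disk n} (hq : IsPlot q) : Continuous q := by
  rw [isPlot_subtype_iff] at hq
  exact continuous_induced_rng.2 hq.contDiff.continuous

lemma exists_foldDisk_eq (y : Disk n) : ∃ x : Disk n, foldDisk n x = y := by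
  have hy : ‖(y : EuclideanSpace ℝ (Fin (n + 1)))‖ ≤ 1 := mem_closedBall_zero_iff.1 y.2
  set s := ‖(y : EuclideanSpace ℝ (Fin (n + 1)))‖ with hs
  have hs0 : 0 ≤ s := norm_nonneg _
  set q := √(1 - s ^ 2) with hq
  have hq0 : 0 ≤ q := Real.sqrt_nonneg _
  have hq2 : q ^ 2 = 1 - s ^ 2 := Real.sq_sqrt (by nlinarith)
  have hnorm : ‖(1 + q)⁻¹ • (y : EuclideanSpace ℝ (Fin (n + 1)))‖ = (1 + q)⁻¹ * s := by
    rw [norm_smul, Real.norm_eq_abs, abs_of_pos (by positivity)]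
  refine ⟨⟨(1 + q)⁻¹ • y.1, ?_⟩, Subtype.ext ?_⟩
  · rw [mem_closedBall_zero_iff, hnorm, inv_mul_le_iff₀ (by positivity)]
    linarith
  · simp only [foldDisk, hnorm, smul_smul]
    convert one_smul ℝ y.1 using 2
    have h1 : (1 + q) ≠ 0 := by positivity
    have h2 : 1 + ((1 + q)⁻¹ * s) ^ 2 ≠ 0 := by positivity
    field_simp
    nlinarith

/-- The D-topology of the closed disk is its subspace topology: the fold map, restricted to the
disk, is a closed continuous surjection of the disk onto itself, and it extends to a plot. -/
instance : IsDTopologyCompatible (Disk n) := by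
  refine ⟨TopologicalSpace.ext_iff.2 fun U => ?_⟩
  rw [isOpen_iff_preimages_plots]
  constructor
  · intro h
    have h1 : IsOpen (foldDisk n ⁻¹' U) := h _ _ isPlot_foldDisk
    have hc : Continuous fun x : Disk n => foldDisk n x :=
      (continuous_disk_of_isPlot isPlot_foldDisk).comp continuous_subtype_val
    have hquot : IsQuotientMap fun x : Disk n => foldDisk n x :=
      hc.isClosedMap.isQuotientMap hc exists_foldDisk_eq
    exact hquot.isOpen_preimage.1 (h1.preimage continuous_subtype_val)
  · intro h k p hp
    exact h.preimage (continuous_disk_of_isPlot hp)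

end Disk

/-! ### Consequences of the universal properties -/

/-- The indiscrete diffeology, for which all maps are plots. -/
@[reducible] def indiscreteDiffeology (Z : Type*) : DiffeologicalSpace Z where
  plots _ := univ
  constant_plots _ := mem_univ _
  plot_reparam _ _ := mem_univ _
  locality _ := mem_univ _

/-- The diffeology whose plots are the maps that agree near each point with a member of `G`. -/
@[reducible] def locallyGeneratedDiffeology {P : Type*} (G : ∀ k, Set (Euc k → P))
    (hconst : ∀ k x, (fun _ => x) ∈ G k)
    (hG : ∀ k m (p : Euc m → P) (e : Euc k → Euc m), p ∈ G m → ContDiff ℝ ∞ e → p ∘ e ∈ G k) :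
    DiffeologicalSpace P where
  plots k := {p | ∀ x, ∃ q ∈ G k, p =ᶠ[𝓝 x] q}
  constant_plots x := fun _ => ⟨_, hconst _ x, Eventually.of_forall fun _ => rfl⟩
  plot_reparam {k m p e} hp he := fun x => by
    obtain ⟨q, hq, hpq⟩ := hp (e x)
    exact ⟨q ∘ e, hG _ _ _ _ hq he, he.continuous.continuousAt.eventually hpq⟩
  locality {k p} h := fun x => by
    obtain ⟨u, hu, hxu, hp⟩ := h x
    obtain ⟨e, he, heu, hex⟩ := exists_contDiff_eventuallyEq_id (hu.mem_nhds hxu)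
    obtain ⟨q, hq, hpq⟩ := hp heu he x
    refine ⟨q, hq, ?_⟩
    filter_upwards [hpq, hex] with y hy hey
    rw [← hy, Function.comp_apply, hey, id]

/-- The inclusion of the sphere into the disk. -/
def sphToDisk {n : ℕ} (s : Sph n) : Disk n := ⟨s.1, Metric.sphere_subset_closedBall s.2⟩

/-- `P` is obtained from `L` by attaching `(n+1)`-disks along `h`. In contrast to the
universal property, this records the underlying set of `P` (`L` together with
disjoint open disks) and its plots (those that locally lift to `L` or to a single disk). -/
structure IsCellExtension {L P ι : Type*} [DiffeologicalSpace L] [DiffeologicalSpace P] {n : ℕ}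
    (h : ι → Sph n → L) (i : L → P) (j : ι → Disk n → P) : Prop where
  smooth_attach : ∀ c, DSmooth (h c)
  smooth_left : DSmooth i
  smooth_right : ∀ c, DSmooth (j c)
  comm : ∀ c s, j c (sphToDisk s) = i (h c s)
  injective : Function.Injective i
  cell_ne : ∀ c (x : Disk n) l, ‖x.1‖ < 1 → j c x ≠ i l
  cell_inj : ∀ c c' (x x' : Disk n), ‖x.1‖ < 1 → ‖x'.1‖ < 1 → j c x = j c' x' → c = c' ∧ x = x'
  lift : ∀ k (p : Euc k → P), IsPlot p → ∀ x,
    (∃ l : Euc k → L, IsPlot l ∧ p =ᶠ[𝓝 x] fun y => i (l y)) ∨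
    (∃ c, ∃ q : Euc k → Disk n, IsPlot q ∧ p =ᶠ[𝓝 x] fun y => j c (q y))

section Pushout

variable {L P ι : Type u} [DiffeologicalSpace L] [DiffeologicalSpace P] {n : ℕ}
  {h : (Σ _ : ι, Sph n) → L} {i : L → P} {j : (Σ _ : ι, Disk n) → P}

lemma IsSmoothPushout.existsUnique_fun {S D : Type u} [DiffeologicalSpace S]
    [DiffeologicalSpace D] {h : S → L} {k : S → D} {i : L → P} {j : D → P}
    (H : IsSmoothPushout h k i j) (Z : Type u) (a : L → Z) (b : D → Z) (hab : a ∘ h = b ∘ k) :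
    ∃! c : P → Z, c ∘ i = a ∧ c ∘ j = b := by
  let _ : DiffeologicalSpace Z := indiscreteDiffeology Z
  have hall : ∀ {Y : Type u} [DiffeologicalSpace Y] (f : Y → Z), DSmooth f :=
    fun f _ _ _ => mem_univ _
  obtain ⟨c, ⟨-, hc⟩, huniq⟩ := H.existsUnique_desc Z a b (hall _) (hall _) hab
  exact ⟨c, hc, fun c' hc' => huniq c' ⟨hall _, hc'⟩⟩

lemma IsSmoothPushout.cover {S D : Type u} [DiffeologicalSpace S]
    [DiffeologicalSpace D] {h : S → L} {k : S → D} {i : L → P} {j : D → P}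
    (H : IsSmoothPushout h k i j) (p : P) : (∃ l, i l = p) ∨ ∃ x, j x = p := by
  obtain ⟨c, -, huniq⟩ := H.existsUnique_fun (ULift Prop) (fun _ => ⟨True⟩) (fun _ => ⟨True⟩) rfl
  have h1 := huniq (fun _ => ⟨True⟩) ⟨rfl, rfl⟩
  have h2 := huniq (fun p => ⟨(∃ l, i l = p) ∨ ∃ x, j x = p⟩)
    ⟨funext fun l => by simp, funext fun x => by simp⟩
  have h3 := congrFun (h1.trans h2.symm) p
  simpa using h3.symm

lemma IsSmoothPushout.isCellExtension (hh : DSmooth h)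
    (H : IsSmoothPushout h (sphIncl n ι) i j) :
    IsCellExtension (fun c s => h ⟨c, s⟩) i (fun c x => j ⟨c, x⟩) := by
  classical
  have hj := dSmooth_sigma_iff.1 H.smooth_right
  have comm : ∀ c s, j ⟨c, sphToDisk s⟩ = i (h ⟨c, s⟩) := fun c s =>
    (congrFun H.comm ⟨c, s⟩).symm
  -- the set-theoretic model of the pushout, with its indiscrete diffeology
  obtain ⟨m, ⟨hmi, hmj⟩, -⟩ := H.existsUnique_fun (L ⊕ (Σ _ : ι, Disk n)) Sum.inl
    (fun x => if hx : ‖x.2.1‖ = 1 then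
      Sum.inl (h ⟨x.1, ⟨x.2.1, mem_sphere_zero_iff_norm.2 hx⟩⟩) else Sum.inr x) (by
      funext s
      have : ‖(sphIncl n ι s).2.1‖ = 1 := mem_sphere_zero_iff_norm.1 s.2.2
      simp only [Function.comp, dif_pos this]
      rfl)
  have hmi' : ∀ l, m (i l) = Sum.inl l := congrFun hmi
  have hmj' : ∀ c (x : Disk n), ‖x.1‖ < 1 → m (j ⟨c, x⟩) = Sum.inr ⟨c, x⟩ := fun c x hx =>
    (congrFun hmj ⟨c, x⟩).trans (dif_neg hx.ne)
  refine ⟨dSmooth_sigma_iff.1 hh, H.smooth_left, hj, comm, ?_, ?_, ?_, ?_⟩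
  · intro l l' hl
    have := congrArg m hl
    rw [hmi', hmi'] at this
    exact Sum.inl_injective this
  · intro c x l hx hl
    have := congrArg m hl
    rw [hmi', hmj' c x hx] at this
    exact Sum.inr_ne_inl this
  · intro c c' x x' hx hx' hxx
    have := congrArg m hxx
    rw [hmj' c x hx, hmj' c' x' hx'] at this
    have := Sum.inr_injective this
    simpa using this
  · -- `P` with the diffeology of the maps that locally lift has the universal property as well
    have hdesc := @IsSmoothPushout.existsUnique_desc _ _ _ _ _ _ _ _ _ _ _ _ H P
    have hfun := H.existsUnique_fun P i j H.comm
    have hcomm := H.comm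
    let G : ∀ k, Set (Euc k → P) := fun k =>
      {p | (∃ l : Euc k → L, IsPlot l ∧ p = fun y => i (l y)) ∨
        ∃ c, ∃ q : Euc k → Disk n, IsPlot q ∧ p = fun y => j ⟨c, q y⟩}
    let P' : DiffeologicalSpace P := locallyGeneratedDiffeology G
      (fun k p => by
        rcases H.cover p with ⟨l, rfl⟩ | ⟨⟨c, x⟩, rfl⟩
        · exact Or.inl ⟨fun _ => l, isPlot_const, rfl⟩
        · exact Or.inr ⟨c, fun _ => x, isPlot_const, rfl⟩)
      (fun k m p e hp he => by
        rcases hp with ⟨l, hl, rfl⟩ | ⟨c, q, hq, rfl⟩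
        · exact Or.inl ⟨l ∘ e, isPlot_reparam hl he, rfl⟩
        · exact Or.inr ⟨c, q ∘ e, isPlot_reparam hq he, rfl⟩)
    have P'_isPlot : ∀ k (p : Euc k → P), @IsPlot P P' k p ↔ ∀ x, ∃ q ∈ G k, p =ᶠ[𝓝 x] q :=
      fun _ _ => Iff.rfl
    clear_value P'
    have hi' : @DSmooth L P _ P' i := fun k l hl => (P'_isPlot _ _).2 fun x =>
      ⟨i ∘ l, Or.inl ⟨l, hl, rfl⟩, EventuallyEq.rfl⟩
    have hj' : @DSmooth (Σ _ : ι, Disk n) P _ P' j := by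
      refine (@dSmooth_sigma_iff P P' ι (fun _ => Disk n) _ j).2 fun c k q hq =>
        (P'_isPlot _ _).2 fun x => ?_
      exact ⟨_, Or.inr ⟨c, q, hq, rfl⟩, EventuallyEq.rfl⟩
    obtain ⟨c, ⟨hc, hci, hcj⟩, -⟩ := @hdesc P' i j hi' hj' hcomm
    have hid : c = id := by
      obtain ⟨c', -, huniq⟩ := hfun
      rw [huniq c ⟨hci, hcj⟩, huniq id ⟨rfl, rfl⟩]
    subst hid
    intro k p hp x
    obtain ⟨q, hq, hpq⟩ := (P'_isPlot _ _).1 (hc k p hp) x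
    rcases hq with ⟨l, hl, rfl⟩ | ⟨c, q, hq, rfl⟩
    · exact Or.inl ⟨l, hl, hpq⟩
    · exact Or.inr ⟨c, q, hq, hpq⟩

end Pushout

/-! ### Attaching cells: descent of maps, topology, collars -/

lemma norm_sphToDisk {n : ℕ} (s : Sph n) : ‖(sphToDisk s).1‖ = 1 := mem_sphere_zero_iff_norm.1 s.2

lemma norm_disk_le {n : ℕ} (x : Disk n) : ‖x.1‖ ≤ 1 := mem_closedBall_zero_iff.1 x.2

lemma exists_sphToDisk_eq {n : ℕ} {x : Disk n} (hx : ¬ ‖x.1‖ < 1) : ∃ s, sphToDisk s = x :=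
  ⟨⟨x.1, mem_sphere_zero_iff_norm.2 (le_antisymm (norm_disk_le x) (not_lt.1 hx))⟩, rfl⟩

/-- The radial projection onto the unit sphere (with an arbitrary value at the origin). -/
def toSph {n : ℕ} (x : EuclideanSpace ℝ (Fin (n + 1))) : Sph n :=
  if hx : x = 0 then ⟨EuclideanSpace.single 0 1, by simp⟩
  else ⟨‖x‖⁻¹ • x, by simp [norm_smul, hx]⟩

lemma toSph_coe {n : ℕ} {x : EuclideanSpace ℝ (Fin (n + 1))} (hx : x ≠ 0) :
    (toSph x : EuclideanSpace ℝ (Fin (n + 1))) = ‖x‖⁻¹ • x := by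
  simp [toSph, hx]

lemma toSph_sphToDisk {n : ℕ} (s : Sph n) : toSph (sphToDisk s).1 = s := by
  have h := norm_sphToDisk s
  refine Subtype.ext ?_
  rw [toSph_coe (by rw [← norm_ne_zero_iff, h]; exact one_ne_zero), h]
  simp [sphToDisk]

lemma isPlot_toSph {n k : ℕ} {q : Euc k → EuclideanSpace ℝ (Fin (n + 1))} (hq : ContDiff ℝ ∞ q)
    (h0 : ∀ y, q y ≠ 0) : IsPlot fun y => toSph (q y) := by
  rw [isPlot_subtype_iff]
  have : (fun y => (toSph (q y) : EuclideanSpace ℝ (Fin (n + 1)))) = fun y => ‖q y‖⁻¹ • q y :=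
    funext fun y => toSph_coe (h0 y)
  rw [this]
  exact (((hq.norm ℝ h0).inv fun y => norm_ne_zero_iff.2 (h0 y)).smul hq).isPlot

namespace IsCellExtension

variable {L P ι : Type*} [DiffeologicalSpace L] [DiffeologicalSpace P] {n : ℕ}
  {h : ι → Sph n → L} {i : L → P} {j : ι → Disk n → P} (H : IsCellExtension h i j)

include H in
lemma cover (p : P) : (∃ l, i l = p) ∨ ∃ y : ι × Disk n, ‖y.2.1‖ < 1 ∧ j y.1 y.2 = p := by
  rcases H.lift 0 (fun _ => p) isPlot_const 0 with ⟨l, -, hl⟩ | ⟨c, q, -, hq⟩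
  · exact Or.inl ⟨_, hl.self_of_nhds.symm⟩
  · by_cases hx : ‖(q 0).1‖ < 1
    · exact Or.inr ⟨(c, q 0), hx, hq.self_of_nhds.symm⟩
    · obtain ⟨s, hs⟩ := exists_sphToDisk_eq hx
      refine Or.inl ⟨h c s, ?_⟩
      rw [← H.comm, hs]
      exact hq.self_of_nhds.symm

include H in
/-- Attaching cells is an induction: a map to `L` that is a plot of `P` is a plot of `L`. -/
lemma isPlot_of_comp {k : ℕ} {p : Euc k → L} (hp : IsPlot fun y => i (p y)) : IsPlot p := by
  refine isPlot_of_forall_nhds fun x => ?_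
  rcases H.lift k _ hp x with ⟨l, hl, hpl⟩ | ⟨c, q, hq, hpq⟩
  · refine ⟨_, hpl, fun e he heu => ?_⟩
    have : p ∘ e = l ∘ e := funext fun y => H.injective (heu y)
    rw [this]
    exact isPlot_reparam hl he
  · refine ⟨_, hpq, fun e he heu => ?_⟩
    -- the lift to the disk takes values in the sphere
    have hs : ∀ y, ∃ s, sphToDisk s = q (e y) := fun y =>
      exists_sphToDisk_eq fun hlt => H.cell_ne _ _ _ hlt (heu y).symm
    choose s hs using hs
    have hsp : IsPlot s := by
      have : (fun y => ((s y : Sph n) : EuclideanSpace ℝ (Fin (n + 1)))) = fun y => (q (e y)).1 :=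
        funext fun y => congrArg Subtype.val (hs y)
      rw [isPlot_subtype_iff, this]
      exact isPlot_reparam (isPlot_subtype_iff.1 hq) he
    have : p ∘ e = h c ∘ s := funext fun y => H.injective <| by
      rw [Function.comp_apply, Function.comp_apply, ← H.comm, hs]; exact heu y
    rw [this]
    exact H.smooth_attach c _ _ hsp

/-- The map on `P` defined by `a` on `L` and by `b c` on the disk with index `c`. -/
def desc {Z : Type*} (a : L → Z) (b : ι → Disk n → Z) (p : P) : Z := by
  classical
  exact if hl : ∃ l, i l = p then a hl.choose
    else b ((H.cover p).resolve_left hl).choose.1 ((H.cover p).resolve_left hl).choose.2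

lemma desc_left {Z : Type*} (a : L → Z) (b : ι → Disk n → Z) (l : L) :
    H.desc a b (i l) = a l := by
  have hl : ∃ l', i l' = i l := ⟨l, rfl⟩
  rw [desc, dif_pos hl, H.injective hl.choose_spec]

lemma desc_right {Z : Type*} {a : L → Z} {b : ι → Disk n → Z}
    (hab : ∀ c s, b c (sphToDisk s) = a (h c s)) (c : ι) (x : Disk n) :
    H.desc a b (j c x) = b c x := by
  by_cases hx : ‖x.1‖ < 1
  · have hl : ¬ ∃ l, i l = j c x := fun ⟨l, hl⟩ => H.cell_ne c x l hx hl.symm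
    have hy := ((H.cover (j c x)).resolve_left hl).choose_spec
    obtain ⟨h1, h2⟩ := H.cell_inj _ _ _ _ hy.1 hx hy.2
    rw [desc, dif_neg hl, h1, h2]
  · obtain ⟨s, rfl⟩ := exists_sphToDisk_eq hx
    rw [H.comm, H.desc_left, hab]

section Smooth

variable {Z F : Type*} [DiffeologicalSpace Z] [DiffeologicalSpace F]

include H in
lemma dSmooth_of {g : P → Z} (hL : DSmooth fun l => g (i l))
    (hD : ∀ c, DSmooth fun x => g (j c x)) : DSmooth g := by
  intro k p hp
  refine isPlot_of_eventuallyEq fun x => ?_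
  rcases H.lift k p hp x with ⟨l, hl, hpl⟩ | ⟨c, q, hq, hpq⟩
  · exact ⟨_, hL _ _ hl, hpl.mono fun y hy => congrArg g hy⟩
  · exact ⟨_, hD c _ _ hq, hpq.mono fun y hy => congrArg g hy⟩

include H in
lemma dSmooth_prod_of {g : F × P → Z} (hL : DSmooth fun y : F × L => g (y.1, i y.2))
    (hD : ∀ c, DSmooth fun y : F × Disk n => g (y.1, j c y.2)) : DSmooth g := by
  intro k p hp
  refine isPlot_of_eventuallyEq fun x => ?_
  rcases H.lift k _ hp.2 x with ⟨l, hl, hpl⟩ | ⟨c, q, hq, hpq⟩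
  · refine ⟨_, hL k (fun y => ((p y).1, l y)) ⟨hp.1, hl⟩, hpl.mono fun y hy => ?_⟩
    simp only [Function.comp, ← hy]
  · refine ⟨_, hD c k (fun y => ((p y).1, q y)) ⟨hp.1, hq⟩, hpq.mono fun y hy => ?_⟩
    simp only [Function.comp, ← hy]

end Smooth

/-- The distance from the centre of a cell, extended by `1` to `L`. -/
def radius : P → ℝ := H.desc (fun _ => 1) fun _ x => ‖x.1‖

lemma radius_left (l : L) : H.radius (i l) = 1 := H.desc_left _ _ _

lemma radius_right (c : ι) (x : Disk n) : H.radius (j c x) = ‖x.1‖ :=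
  H.desc_right (fun _ s => norm_sphToDisk s) c x

/-- The radial retraction onto `L` of the complement of the centres of the cells (with arbitrary
values at the centres). -/
def collar : P → L := H.desc id fun c x => h c (toSph x.1)

lemma collar_left (l : L) : H.collar (i l) = l := H.desc_left _ _ _

lemma collar_right (c : ι) (x : Disk n) : H.collar (j c x) = h c (toSph x.1) :=
  H.desc_right (fun c s => by rw [toSph_sphToDisk]; rfl) c x

lemma isPlot_collar {k : ℕ} {p : Euc k → P} (hp : IsPlot p) (h0 : ∀ y, 0 < H.radius (p y)) :
    IsPlot fun y => H.collar (p y) := by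
  refine isPlot_of_forall_nhds fun x => ?_
  rcases H.lift k _ hp x with ⟨l, hl, hpl⟩ | ⟨c, q, hq, hpq⟩
  · refine ⟨_, hpl, fun e he heu => ?_⟩
    have : (fun y => H.collar (p y)) ∘ e = l ∘ e := funext fun y => by
      have := heu y
      simp only [mem_ofPred_eq] at this
      simp [this, H.collar_left]
    rw [this]
    exact isPlot_reparam hl he
  · refine ⟨_, hpq, fun e he heu => ?_⟩
    have heu' : ∀ y, p (e y) = j c (q (e y)) := heu
    have : (fun y => H.collar (p y)) ∘ e = h c ∘ fun y => toSph (q (e y)).1 := funext fun y => by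
      simp [heu' y, H.collar_right]
    rw [this]
    refine H.smooth_attach c _ _ (isPlot_toSph ?_ fun y => ?_)
    · exact (isPlot_subtype_iff.1 hq).contDiff.comp he
    · have := h0 (e y)
      rw [heu' y, H.radius_right] at this
      exact norm_pos_iff.1 this

section Deformation

variable {F : Type*} (Θ : F → EuclideanSpace ℝ (Fin (n + 1)) → EuclideanSpace ℝ (Fin (n + 1)))
  (hball : ∀ a x, ‖x‖ ≤ 1 → ‖Θ a x‖ ≤ 1) (hsph : ∀ a x, ‖x‖ = 1 → Θ a x = x)

/-- The family of self-maps of `P` given on all disks by a family of self-maps `Θ a` of the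
disk. It is well-defined if the `Θ a` fix the sphere. -/
def cellMap (a : F) : P → P :=
  H.desc i fun c x => j c ⟨Θ a x.1, mem_closedBall_zero_iff.2 (hball a x.1 (norm_disk_le x))⟩

lemma cellMap_left (a : F) (l : L) : H.cellMap Θ hball a (i l) = i l := H.desc_left _ _ _

include hsph in
lemma cellMap_right (a : F) (c : ι) (x : Disk n) : H.cellMap Θ hball a (j c x) =
    j c ⟨Θ a x.1, mem_closedBall_zero_iff.2 (hball a x.1 (norm_disk_le x))⟩ := by
  refine H.desc_right (fun c s => ?_) c x
  rw [← H.comm]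
  exact congrArg (j c) (Subtype.ext (hsph a _ (norm_sphToDisk s)))

include hsph in
lemma cellMap_eq_self {a : F} (ha : ∀ x, Θ a x = x) (p : P) : H.cellMap Θ hball a p = p := by
  rcases H.cover p with ⟨l, rfl⟩ | ⟨⟨c, x⟩, -, rfl⟩
  · rw [cellMap_left]
  · rw [H.cellMap_right Θ hball hsph]
    exact congrArg (j c) (Subtype.ext (ha _))

include hsph in
lemma dSmooth_cellMap [NormedAddCommGroup F] [NormedSpace ℝ F] [DiffeologicalSpace F]
    [IsContDiffCompatible F]
    (hΘ : ContDiff ℝ ∞ fun y : F × EuclideanSpace ℝ (Fin (n + 1)) => Θ y.1 y.2) :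
    DSmooth fun y : F × P => H.cellMap Θ hball y.1 y.2 := by
  refine H.dSmooth_prod_of ?_ fun c => ?_
  · simp only [cellMap_left]
    exact fun k p hp => H.smooth_left _ _ hp.2
  · simp only [H.cellMap_right Θ hball hsph]
    intro k p hp
    refine H.smooth_right c k (fun y => ⟨Θ (p y).1 (p y).2.1, _⟩) ?_
    rw [isPlot_subtype_iff]
    exact (hΘ.comp (hp.1.contDiff.prodMk (isPlot_subtype_iff.1 hp.2).contDiff)).isPlot

end Deformation

section Topological

variable [TopologicalSpace L] [IsDTopologyCompatible L] [TopologicalSpace P]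
  [IsDTopologyCompatible P]

include H in
lemma isOpen_iff {U : Set P} : IsOpen U ↔ IsOpen (i ⁻¹' U) ∧ ∀ c, IsOpen (j c ⁻¹' U) := by
  refine ⟨fun hU => ⟨hU.preimage H.smooth_left.continuous',
    fun c => hU.preimage (H.smooth_right c).continuous'⟩, fun hU => ?_⟩
  refine isOpen_iff_plots.2 fun k p hp => isOpen_iff_mem_nhds.2 fun x hx => ?_
  rcases H.lift k p hp x with ⟨l, hl, hpl⟩ | ⟨c, q, hq, hpq⟩
  · have hx' : x ∈ l ⁻¹' (i ⁻¹' U) := by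
      have := hpl.self_of_nhds; simpa [this] using hx
    filter_upwards [hpl, (hU.1.preimage (continuous_of_isPlot hl)).mem_nhds hx'] with y hy hyU
    simpa [hy] using hyU
  · have hx' : x ∈ q ⁻¹' (j c ⁻¹' U) := by
      have := hpq.self_of_nhds; simpa [this] using hx
    filter_upwards [hpq, ((hU.2 c).preimage (continuous_of_isPlot hq)).mem_nhds hx'] with y hy hyU
    simpa [hy] using hyU

include H in
lemma continuous_of {Z : Type*} [TopologicalSpace Z] {g : P → Z} (hL : Continuous fun l => g (i l))
    (hD : ∀ c, Continuous fun x => g (j c x)) : Continuous g :=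
  continuous_def.2 fun _ hU => H.isOpen_iff.2 ⟨hU.preimage hL, fun c => hU.preimage (hD c)⟩

include H in
lemma continuous_prod_of {Z F : Type*} [TopologicalSpace Z] [TopologicalSpace F]
    [LocallyCompactSpace F] {g : F × P → Z} (hL : Continuous fun y : F × L => g (y.1, i y.2))
    (hD : ∀ c, Continuous fun y : F × Disk n => g (y.1, j c y.2)) : Continuous g := by
  have hg : ∀ p, Continuous fun a => g (a, p) := by
    intro p
    rcases H.cover p with ⟨l, rfl⟩ | ⟨⟨c, x⟩, -, rfl⟩
    · exact hL.comp (by fun_prop : Continuous fun a : F => (a, l))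
    · exact (hD c).comp (by fun_prop : Continuous fun a : F => (a, x))
  -- as `F` is locally compact, it suffices that the adjoint map `P → C(F, Z)` is continuous
  let G : P → C(F, Z) := fun p => ⟨_, hg p⟩
  have hG : Continuous G := H.continuous_of
    (ContinuousMap.curry ⟨fun y : L × F => g (y.2, i y.1), hL.comp continuous_swap⟩).continuous
    fun c => (ContinuousMap.curry
      ⟨fun y : Disk n × F => g (y.2, j c y.1), (hD c).comp continuous_swap⟩).continuous
  exact (ContinuousMap.continuous_uncurry_of_continuous ⟨G, hG⟩).comp continuous_swap

lemma continuous_radius : Continuous H.radius :=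
  H.continuous_of (by simp only [radius_left]; exact continuous_const)
    fun c => by simp only [radius_right]; fun_prop

omit [TopologicalSpace P] [IsDTopologyCompatible P] in
include H in
lemma continuousOn_attach (c : ι) : ContinuousOn (fun x => h c (toSph x)) {0}ᶜ := by
  intro x hx
  obtain ⟨e, he, heu, hex⟩ :=
    exists_contDiff_eventuallyEq_id (isOpen_compl_singleton.mem_nhds hx)
  have h1 : Continuous fun y => h c (toSph (e y)) :=
    continuous_of_isPlot (H.smooth_attach c _ _ (isPlot_toSph he heu))
  refine (h1.continuousAt.congr ?_).continuousWithinAt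
  filter_upwards [hex] with y hy
  rw [hy, id]

lemma continuousOn_collar : ContinuousOn H.collar {p | 0 < H.radius p} := by
  have ho : IsOpen {p | 0 < H.radius p} := isOpen_lt continuous_const H.continuous_radius
  rw [continuousOn_open_iff ho]
  intro V hV
  refine H.isOpen_iff.2 ⟨?_, fun c => ?_⟩
  · convert hV using 1
    ext l
    simp [radius_left, collar_left]
  · have h1 := (H.continuousOn_attach c).isOpen_inter_preimage isOpen_compl_singleton hV
    convert h1.preimage (continuous_subtype_val (p := fun x => x ∈ Metric.closedBall _ _)) using 1
    ext x
    simp [radius_right, collar_right]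

lemma continuous_cellMap {F : Type*} [TopologicalSpace F] [LocallyCompactSpace F]
    (Θ : F → EuclideanSpace ℝ (Fin (n + 1)) → EuclideanSpace ℝ (Fin (n + 1)))
    (hball : ∀ a x, ‖x‖ ≤ 1 → ‖Θ a x‖ ≤ 1) (hsph : ∀ a x, ‖x‖ = 1 → Θ a x = x)
    (hΘ : Continuous fun y : F × EuclideanSpace ℝ (Fin (n + 1)) => Θ y.1 y.2) :
    Continuous fun y : F × P => H.cellMap Θ hball y.1 y.2 := by
  refine H.continuous_prod_of ?_ fun c => ?_
  · simp only [cellMap_left]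
    exact H.smooth_left.continuous'.comp continuous_snd
  · simp only [H.cellMap_right Θ hball hsph]
    refine (H.smooth_right c).continuous'.comp (Continuous.subtype_mk ?_ _)
    exact hΘ.comp (by fun_prop : Continuous fun y : F × Disk n => (y.1, y.2.1))

include H in
lemma isClosedEmbedding : IsClosedEmbedding i := by
  refine .of_continuous_injective_isClosedMap H.smooth_left.continuous' H.injective fun C hC => ?_
  refine isOpen_compl_iff.1 (H.isOpen_iff.2 ⟨?_, fun c => ?_⟩)
  · rw [preimage_compl, preimage_image_eq _ H.injective]
    exact hC.isOpen_compl
  · rw [preimage_compl, isOpen_compl_iff]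
    have h1 : IsClosed (Metric.sphere (0 : EuclideanSpace ℝ (Fin (n + 1))) 1 ∩
        (fun x => h c (toSph x)) ⁻¹' C) := by
      refine ((H.continuousOn_attach c).mono fun x hx => ?_).preimage_isClosed_of_isClosed
        Metric.isClosed_sphere hC
      rintro rfl
      simp at hx
    convert h1.preimage (continuous_subtype_val (p := fun x => x ∈ Metric.closedBall _ _)) using 1
    ext x
    constructor
    · rintro ⟨l, hl, hlx⟩
      have hx : ¬ ‖x.1‖ < 1 := fun hx => H.cell_ne c x l hx hlx.symm
      obtain ⟨s, rfl⟩ := exists_sphToDisk_eq hx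
      refine ⟨s.2, ?_⟩
      rw [H.comm] at hlx
      change h c (toSph (sphToDisk s).1) ∈ C
      rw [toSph_sphToDisk, ← H.injective hlx]
      exact hl
    · rintro ⟨hx, hxC⟩
      have hx' : ¬ ‖x.1‖ < 1 := (mem_sphere_zero_iff_norm.1 hx).not_lt
      obtain ⟨s, rfl⟩ := exists_sphToDisk_eq hx'
      change h c (toSph (sphToDisk s).1) ∈ C at hxC
      rw [toSph_sphToDisk] at hxC
      exact ⟨_, hxC, (H.comm c s).symm⟩

include H in
lemma t1Space [T1Space L] : T1Space P := by
  refine ⟨fun p => ?_⟩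
  rcases H.cover p with ⟨l, rfl⟩ | ⟨⟨c, x⟩, hx, rfl⟩
  · rw [← image_singleton]
    exact H.isClosedEmbedding.isClosedMap _ isClosed_singleton
  · refine isOpen_compl_iff.1 (H.isOpen_iff.2 ⟨?_, fun c' => ?_⟩)
    · convert isOpen_univ
      refine eq_univ_of_forall fun l hl => H.cell_ne c x l hx ?_
      exact (mem_singleton_iff.1 hl).symm
    · rw [preimage_compl, isOpen_compl_iff]
      refine Set.Subsingleton.isClosed fun y hy z hz => ?_
      have hlt : ∀ y, j c' y = j c x → ‖y.1‖ < 1 := by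
        intro y hy
        by_contra hlt
        obtain ⟨s, rfl⟩ := exists_sphToDisk_eq hlt
        rw [H.comm] at hy
        exact H.cell_ne c x _ hx hy.symm
      have hyz : j c' y = j c' z :=
        (mem_singleton_iff.1 hy).trans (mem_singleton_iff.1 hz).symm
      exact (H.cell_inj _ _ _ _ (hlt y hy) (hlt z hz) hyz).2

end Topological

end IsCellExtension

/-! ### Smoothing inside the cells and collapsing collars -/

section Profiles

variable {E : Type*} [NormedAddCommGroup E] [InnerProductSpace ℝ E]

/-- The identity of the ball of radius `9/10`, cut off smoothly before the unit sphere. -/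
def coreProfile (x : E) : E := Real.smoothTransition ((9 / 10 - ‖x‖ ^ 2) * 20) • x

lemma contDiff_coreProfile : ContDiff ℝ ∞ (coreProfile : E → E) :=
  (Real.smoothTransition.contDiff.comp
    ((contDiff_const.sub (contDiff_norm_sq ℝ)).mul contDiff_const)).smul contDiff_id

lemma coreProfile_of_norm_le {x : E} (hx : ‖x‖ ≤ 9 / 10) : coreProfile x = x := by
  rw [coreProfile, Real.smoothTransition.one_of_one_le, one_smul]
  nlinarith [norm_nonneg x]

lemma coreProfile_of_norm_eq_one {x : E} (hx : ‖x‖ = 1) : coreProfile x = 0 := by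
  rw [coreProfile, Real.smoothTransition.zero_of_nonpos, zero_smul]
  rw [hx]; norm_num

/-- The bump function used to make translation vectors short. -/
def shortBump (E : Type*) [NormedAddCommGroup E] : ContDiffBump (0 : E) :=
  ⟨1 / 20, 1 / 10, by norm_num, by norm_num⟩

variable [FiniteDimensional ℝ E]

/-- Translation by `v` (shortened to norm at most `1/10`) in the ball of radius `8/10`,
cut off smoothly before the unit sphere. -/
def translationProfile (v x : E) : E :=
  x + Real.smoothTransition ((72 / 100 - ‖x‖ ^ 2) * 20) • (shortBump E v • v)

lemma contDiff_translationProfile :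
    ContDiff ℝ ∞ fun y : E × E => translationProfile y.1 y.2 := by
  have h1 : ContDiff ℝ ∞ fun y : E × E =>
      Real.smoothTransition ((72 / 100 - ‖y.2‖ ^ 2) * 20) :=
    Real.smoothTransition.contDiff.comp
      ((contDiff_const.sub (contDiff_snd.norm_sq ℝ)).mul contDiff_const)
  have h2 : ContDiff ℝ ∞ fun y : E × E => shortBump E y.1 • y.1 :=
    ((shortBump E).contDiff.comp contDiff_fst).smul contDiff_fst
  exact contDiff_snd.add (h1.smul h2)

lemma norm_shortBump_smul_le (v : E) : ‖shortBump E v • v‖ ≤ 1 / 10 := by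
  rw [norm_smul, Real.norm_eq_abs, abs_of_nonneg (shortBump E).nonneg]
  by_cases hv : ‖v‖ ≤ 1 / 10
  · calc shortBump E v * ‖v‖ ≤ 1 * ‖v‖ := by gcongr; exact (shortBump E).le_one
      _ ≤ 1 / 10 := by linarith
  · rw [(shortBump E).zero_of_le_dist (by rw [dist_zero_right]; exact (not_le.1 hv).le), zero_mul]
    norm_num

lemma norm_smul_shortBump_le (t : ℝ) (v : E) :
    ‖Real.smoothTransition t • (shortBump E v • v)‖ ≤ ‖shortBump E v • v‖ := by
  rw [norm_smul, Real.norm_eq_abs, abs_of_nonneg (Real.smoothTransition.nonneg t)]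
  exact mul_le_of_le_one_left (norm_nonneg _) (Real.smoothTransition.le_one t)

lemma translationProfile_of_le {v x : E} (hx : 72 / 100 ≤ ‖x‖ ^ 2) :
    translationProfile v x = x := by
  rw [translationProfile, Real.smoothTransition.zero_of_nonpos, zero_smul, add_zero]
  linarith

lemma norm_translationProfile_le (v x : E) (hx : ‖x‖ ≤ 1) : ‖translationProfile v x‖ ≤ 1 := by
  by_cases h : 72 / 100 ≤ ‖x‖ ^ 2
  · rwa [translationProfile_of_le h]
  · have h1 : ‖x‖ ≤ 9 / 10 := by nlinarith [norm_nonneg x]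
    have h2 := (norm_smul_shortBump_le ((72 / 100 - ‖x‖ ^ 2) * 20) v).trans
      (norm_shortBump_smul_le v)
    exact (norm_add_le _ _).trans (by linarith)

lemma translationProfile_of_norm_eq_one (v x : E) (hx : ‖x‖ = 1) : translationProfile v x = x :=
  translationProfile_of_le (by rw [hx]; norm_num)

lemma translationProfile_zero (x : E) : translationProfile 0 x = x := by
  simp [translationProfile]

lemma shortBump_eq_one {v : E} (hv : ‖v‖ ≤ 1 / 20) : shortBump E v = 1 :=
  (shortBump E).one_of_mem_closedBall (by simpa [shortBump] using hv)

lemma translationProfile_of_norm_le {v x : E} (hv : ‖v‖ ≤ 1 / 20) (hx : ‖x‖ ≤ 8 / 10) :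
    translationProfile v x = x + v := by
  rw [translationProfile, shortBump_eq_one hv, Real.smoothTransition.one_of_one_le, one_smul,
    one_smul]
  nlinarith [norm_nonneg x]

lemma norm_sub_le_norm_translationProfile {v : E} (hv : ‖v‖ ≤ 1 / 20) (x : E) :
    ‖x‖ - 1 / 20 ≤ ‖translationProfile v x‖ := by
  have h2 := norm_smul_shortBump_le ((72 / 100 - ‖x‖ ^ 2) * 20) v
  rw [shortBump_eq_one hv, one_smul] at h2
  rw [translationProfile, shortBump_eq_one hv, one_smul]
  have := norm_sub_le_norm_add x (Real.smoothTransition ((72 / 100 - ‖x‖ ^ 2) * 20) • v)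
  linarith

/-- The radial homotopy from the identity (`s = 0`) to a map that projects the collar
`1/2 ≤ ‖x‖ ≤ 1` to the unit sphere (`s = 1`). -/
def collapseProfile (s : ℝ) (x : E) : E :=
  (1 + Real.smoothTransition s *
    (Real.smoothTransition ((‖x‖ ^ 2 - 1 / 16) * 8) * (‖x‖⁻¹ - 1))) • x

omit [FiniteDimensional ℝ E] in
lemma contDiff_collapseProfile : ContDiff ℝ ∞ fun y : ℝ × E => collapseProfile y.1 y.2 := by
  have h1 : ContDiff ℝ ∞ fun x : E =>
      Real.smoothTransition ((‖x‖ ^ 2 - 1 / 16) * 8) * (‖x‖⁻¹ - 1) := by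
    rw [contDiff_iff_contDiffAt]
    intro x
    by_cases hx : x = 0
    · -- the function vanishes near the origin
      have h0 : ∀ᶠ y : E in 𝓝 x, ‖y‖ ^ 2 < 1 / 16 :=
        (continuous_norm.pow 2).continuousAt.eventually_lt continuousAt_const (by simp [hx])
      refine (contDiffAt_const (c := (0 : ℝ))).congr_of_eventuallyEq ?_
      filter_upwards [h0] with y hy
      rw [Real.smoothTransition.zero_of_nonpos (by linarith), zero_mul]
    · refine ContDiffAt.mul (ContDiff.contDiffAt ?_) ?_
      · exact Real.smoothTransition.contDiff.comp
          (((contDiff_norm_sq ℝ).sub contDiff_const).mul contDiff_const)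
      · exact ((contDiffAt_norm ℝ hx).inv (norm_ne_zero_iff.2 hx)).sub contDiffAt_const
  exact (contDiff_const.add ((Real.smoothTransition.contDiff.comp contDiff_fst).mul
    (h1.comp contDiff_snd))).smul contDiff_snd

omit [FiniteDimensional ℝ E] in
lemma norm_collapseProfile_le (s : ℝ) (x : E) (hx : ‖x‖ ≤ 1) : ‖collapseProfile s x‖ ≤ 1 := by
  by_cases h0 : x = 0
  · simp [collapseProfile, h0]
  have hpos : 0 < ‖x‖ := norm_pos_iff.2 h0
  set a := Real.smoothTransition s
  set b := Real.smoothTransition ((‖x‖ ^ 2 - 1 / 16) * 8)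
  have ha : 0 ≤ a := Real.smoothTransition.nonneg _
  have hb : 0 ≤ b := Real.smoothTransition.nonneg _
  have hab : a * b ≤ 1 :=
    mul_le_one₀ (Real.smoothTransition.le_one _) hb (Real.smoothTransition.le_one _)
  have hinv : 0 ≤ ‖x‖⁻¹ - 1 := sub_nonneg.2 (one_le_inv_iff₀.2 ⟨hpos, hx⟩)
  rw [collapseProfile, norm_smul, Real.norm_eq_abs, abs_of_nonneg (by positivity)]
  have : (1 + a * (b * (‖x‖⁻¹ - 1))) * ‖x‖ = ‖x‖ + a * b * (1 - ‖x‖) := by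
    field_simp
  rw [this]
  nlinarith

omit [FiniteDimensional ℝ E] in
lemma collapseProfile_of_norm_eq_one (s : ℝ) (x : E) (hx : ‖x‖ = 1) : collapseProfile s x = x := by
  simp [collapseProfile, hx]

omit [FiniteDimensional ℝ E] in
lemma collapseProfile_zero (x : E) : collapseProfile 0 x = x := by
  simp [collapseProfile]

omit [FiniteDimensional ℝ E] in
lemma collapseProfile_one {x : E} (hx : 1 / 2 ≤ ‖x‖) : collapseProfile 1 x = ‖x‖⁻¹ • x := by
  rw [collapseProfile, Real.smoothTransition.one,
    Real.smoothTransition.one_of_one_le (by nlinarith)]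
  congr 1
  ring

end Profiles

lemma homotopicRel_mono {M X : Type*} [TopologicalSpace M] [TopologicalSpace X] {f g : C(M, X)}
    {S T : Set M} (h : f.HomotopicRel g T) (hST : S ⊆ T) : f.HomotopicRel g S :=
  h.map fun F => ⟨F.toHomotopy, fun t x hx => F.prop t x (hST hx)⟩

namespace IsCellExtension

variable {L P ι : Type*} [DiffeologicalSpace L] [DiffeologicalSpace P] {n : ℕ}
  {h : ι → Sph n → L} {i : L → P} {j : ι → Disk n → P} (H : IsCellExtension h i j)
  {d : ℕ} {M : Type v} [TopologicalSpace M]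

/-- The coordinate in `ℝⁿ⁺¹` of the points of the cells, cut off before the boundary. -/
def core : P → EuclideanSpace ℝ (Fin (n + 1)) := H.desc (fun _ => 0) fun _ x => coreProfile x.1

lemma core_left (l : L) : H.core (i l) = 0 := H.desc_left _ _ _

lemma core_right (c : ι) (x : Disk n) : H.core (j c x) = coreProfile x.1 :=
  H.desc_right (fun _ s => coreProfile_of_norm_eq_one (norm_sphToDisk s)) c x

lemma dSmooth_core : DSmooth H.core :=
  H.dSmooth_of (by simp only [core_left]; exact dSmooth_const) fun c => by
    simp only [core_right]
    exact contDiff_coreProfile.dSmooth.comp dSmooth_subtype_val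

lemma dSmoothAt_collar [ChartedSpace (EuclideanSpace ℝ (Fin d)) M] {f : M → P} {m : M}
    (hf : DSmoothAt d f m) (hpos : ∀ᶠ m' in 𝓝 m, 0 < H.radius (f m')) :
    DSmoothAt d (fun x => H.collar (f x)) m := by
  obtain ⟨U, hU, hm, hp⟩ := hf
  obtain ⟨V, hV, hoV, hmV⟩ := eventually_nhds_iff.1 hpos
  exact ⟨U ∩ V, hU.inter hoV, ⟨hm, hmV⟩, fun k p hps hpU =>
    H.isPlot_collar (hp k p hps fun x => (hpU x).1) fun x => hV _ (hpU x).2⟩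

variable [TopologicalSpace L] [IsDTopologyCompatible L] [TopologicalSpace P]
  [IsDTopologyCompatible P]

/-- A continuous map is homotopic to its image under a family of deformations of the cells, with
parameter depending on the point of the source. -/
lemma homotopicRel_cellMap {F : Type*} [NormedAddCommGroup F] [NormedSpace ℝ F]
    [FiniteDimensional ℝ F]
    (Θ : F → EuclideanSpace ℝ (Fin (n + 1)) → EuclideanSpace ℝ (Fin (n + 1)))
    (hball : ∀ a x, ‖x‖ ≤ 1 → ‖Θ a x‖ ≤ 1) (hsph : ∀ a x, ‖x‖ = 1 → Θ a x = x)
    (hΘ : Continuous fun y : F × EuclideanSpace ℝ (Fin (n + 1)) => Θ y.1 y.2)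
    (h0 : ∀ x, Θ 0 x = x) (f : C(M, P)) {a : M → F} (ha : Continuous a) {A : Set M}
    (haA : EqOn a 0 A) :
    ∃ f' : C(M, P), (∀ m, f' m = H.cellMap Θ hball (a m) (f m)) ∧ f.HomotopicRel f' A := by
  have : ProperSpace F := FiniteDimensional.proper_real F
  have hc := H.continuous_cellMap Θ hball hsph hΘ
  have hK : Continuous fun y : unitInterval × M =>
      H.cellMap Θ hball ((y.1 : ℝ) • a y.2) (f y.2) :=
    hc.comp (by fun_prop : Continuous fun y : unitInterval × M => ((y.1 : ℝ) • a y.2, f y.2))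
  have hf' : Continuous fun m => H.cellMap Θ hball (a m) (f m) :=
    hc.comp (by fun_prop : Continuous fun m => (a m, f m))
  refine ⟨⟨_, hf'⟩, fun m => rfl, ⟨⟨⟨⟨_, hK⟩, fun m => ?_, fun m => ?_⟩, fun t m hm => ?_⟩⟩⟩
  · simpa using H.cellMap_eq_self Θ hball hsph h0 (f m)
  · simp
  · have : a m = 0 := haA hm
    simpa [this] using H.cellMap_eq_self Θ hball hsph h0 (f m)

variable [ChartedSpace (EuclideanSpace ℝ (Fin d)) M]

include H in
/-- The open cells are open. -/
lemma isOpen_openCell (c : ι) : IsOpen {p | ∃ x : Disk n, ‖x.1‖ < 1 ∧ j c x = p} := by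
  refine H.isOpen_iff.2 ⟨?_, fun c' => ?_⟩
  · convert isOpen_empty
    refine eq_empty_of_forall_notMem ?_
    rintro l ⟨x, hx, hl⟩
    exact H.cell_ne c x l hx hl
  · have hlt : ∀ y, (∃ x : Disk n, ‖x.1‖ < 1 ∧ j c x = j c' y) → ‖y.1‖ < 1 := by
      rintro y ⟨x, hx, hxy⟩
      by_contra hy
      obtain ⟨s, rfl⟩ := exists_sphToDisk_eq hy
      rw [H.comm] at hxy
      exact H.cell_ne c x _ hx hxy
    by_cases hcc : c = c'
    · subst hcc
      have : j c ⁻¹' {p | ∃ x : Disk n, ‖x.1‖ < 1 ∧ j c x = p} = {x | ‖x.1‖ < 1} :=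
        Set.ext fun y => ⟨hlt y, fun hy => ⟨y, hy, rfl⟩⟩
      rw [this]
      exact isOpen_lt (by fun_prop) continuous_const
    · convert isOpen_empty
      refine eq_empty_of_forall_notMem fun y hy => ?_
      obtain ⟨x, hx, hxy⟩ := hy
      exact hcc (H.cell_inj _ _ _ _ hx (hlt y ⟨x, hx, hxy⟩) hxy).1

variable [T2Space M] [SigmaCompactSpace M] [IsManifold (𝓡 d) ∞ M]

/-- A continuous map to `P` can be made smooth over the parts `‖x‖ < 3/4` of the cells: approximate
its coordinate in the cells and translate accordingly. -/
theorem exists_homotopicRel_smooth_in_cells (f : C(M, P)) {A B : Set M} (hA : IsClosed A)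
    (hB : IsOpen B) (hAB : A ⊆ B) (hf : ∀ m ∈ B, DSmoothAt d f m) :
    ∃ f' : C(M, P), f.HomotopicRel f' A ∧
      ∀ m, H.radius (f' m) < 3 / 4 → DSmoothAt d f' m := by
  have hFc : Continuous fun m => H.core (f m) := H.dSmooth_core.continuous'.comp f.continuous
  obtain ⟨G, hG, hGA, -⟩ := hFc.exists_contMDiff_approx_and_eqOn (𝓡 d) (⊤ : ℕ∞)
    (ε := fun _ => 1 / 20) continuous_const (fun _ => by norm_num) hA
    (hB.mem_nhdsSet.2 hAB)
    (fun m hm => ((hf m hm).dSmooth_comp H.dSmooth_core).contMDiffAt.contMDiffWithinAt)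
  have hGs : ∀ m, DSmoothAt d (fun m => G m) m := fun m => dSmoothAt_of_contMDiff G.contMDiff m
  have hGF : ∀ m, ‖G m - H.core (f m)‖ ≤ 1 / 20 := fun m => by
    rw [← dist_eq_norm]; exact (hG m).le
  have hGc : Continuous G := G.contMDiff.continuous
  obtain ⟨f', hf', hff'⟩ := H.homotopicRel_cellMap translationProfile norm_translationProfile_le
    translationProfile_of_norm_eq_one contDiff_translationProfile.continuous
    translationProfile_zero f (a := fun m => G m - H.core (f m)) (hGc.sub hFc) (A := A)
    (fun m hm => by simp [hGA hm])
  refine ⟨f', hff', fun m hm => ?_⟩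
  have hcell := H.cellMap_right (translationProfile (E := EuclideanSpace ℝ (Fin (n + 1))))
    norm_translationProfile_le translationProfile_of_norm_eq_one
  -- the point `f m` lies well inside a cell, as it has been moved by at most `1/20`
  have hrad : H.radius (f m) < 8 / 10 := by
    rw [hf'] at hm
    rcases H.cover (f m) with ⟨l, hl⟩ | ⟨⟨c, x⟩, -, hx⟩
    · rw [← hl, cellMap_left, radius_left] at hm
      norm_num at hm
    · rw [← hx, hcell, radius_right] at hm
      rw [← hx, radius_right]
      have := norm_sub_le_norm_translationProfile (hGF m) x.1
      rw [← hx] at this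
      linarith
  rcases H.cover (f m) with ⟨l, hl⟩ | ⟨⟨c, x⟩, hxlt, hx⟩
  · rw [← hl, radius_left] at hrad
    norm_num at hrad
  have h1 : ∀ᶠ m' in 𝓝 m, ∃ x : Disk n, ‖x.1‖ < 1 ∧ j c x = f m' :=
    f.continuous.continuousAt.eventually ((H.isOpen_openCell c).mem_nhds ⟨x, hxlt, hx⟩)
  have h2 : ∀ᶠ m' in 𝓝 m, H.radius (f m') < 8 / 10 :=
    (H.continuous_radius.comp f.continuous).continuousAt.eventually_lt continuousAt_const hrad
  -- near `m`, the new map is `G`, viewed as a map to the disk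
  have h3 : ∀ᶠ m' in 𝓝 m, ∃ hm' : ‖G m'‖ ≤ 1,
      f' m' = j c ⟨G m', mem_closedBall_zero_iff.2 hm'⟩ := by
    filter_upwards [h1, h2] with m' hm1 hm2
    obtain ⟨y, -, hy⟩ := hm1
    rw [← hy, radius_right] at hm2
    have hcore : H.core (f m') = y.1 := by
      rw [← hy, core_right, coreProfile_of_norm_le (by linarith)]
    have hGy := hGF m'
    rw [hcore] at hGy
    have hval : translationProfile (G m' - H.core (f m')) y.1 = G m' := by
      rw [hcore, translationProfile_of_norm_le hGy hm2.le]; abel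
    have hle := norm_translationProfile_le (G m' - H.core (f m')) y.1 (norm_disk_le y)
    rw [hval] at hle
    refine ⟨hle, ?_⟩
    rw [hf', ← hy, hcell]
    congr 1
    exact Subtype.ext (by rw [hy]; exact hval)
  obtain ⟨U, hU, hoU, hmU⟩ := eventually_nhds_iff.1 h3
  refine dSmoothAt_of_isOpen hoU hmU fun k p hps hpU => ?_
  have : f' ∘ p = j c ∘ fun y => ⟨G (p y), mem_closedBall_zero_iff.2 (hU _ (hpU y)).1⟩ :=
    funext fun y => (hU _ (hpU y)).2
  rw [this]
  refine H.smooth_right c _ _ ?_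
  rw [isPlot_subtype_iff]
  exact (G.contMDiff.comp hps).contDiff.isPlot

end IsCellExtension

/-- The smooth approximation property is inherited when cells are attached. After smoothing inside
the cells, the collars of the cells are collapsed away from `A`; where the resulting map is not yet
smooth, it takes values in `L`. -/
theorem Approximable.of_isCellExtension {d : ℕ} {L P ι : Type*} [DiffeologicalSpace L]
    [DiffeologicalSpace P] {n : ℕ} {h : ι → Sph n → L} {i : L → P} {j : ι → Disk n → P}
    (H : IsCellExtension h i j) [TopologicalSpace L] [IsDTopologyCompatible L]
    [TopologicalSpace P] [IsDTopologyCompatible P] (hL : Approximable.{v} d L) :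
    Approximable.{v} d P := by
  intro M _ _ _ _ _ f A B hA hB hAB hf
  have : NormalSpace M := normalSpace_of_chartedSpace d M
  obtain ⟨U₀, hU₀, hAU₀, hU₀B⟩ := normal_exists_closure_subset hA hB hAB
  obtain ⟨U₁, hU₁, hU₀₁, hU₁B⟩ := normal_exists_closure_subset isClosed_closure hB hU₀B
  obtain ⟨U₂, hU₂, hU₁₂, hU₂B⟩ := normal_exists_closure_subset isClosed_closure hB hU₁B
  obtain ⟨f₁, hff₁, hf₁⟩ :=
    H.exists_homotopicRel_smooth_in_cells f isClosed_closure hB hU₂B hf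
  have hf₁U : ∀ m ∈ U₂, DSmoothAt d f₁ m := fun m hm => by
    refine (hf m (hU₂B (subset_closure hm))).congr ?_
    filter_upwards [hU₂.mem_nhds hm] with m' hm' using hff₁.fst_eq_snd (subset_closure hm')
  -- collapse the collars, away from `A`
  obtain ⟨s, hs0, hs1, -⟩ := exists_contMDiffMap_zero_one_of_isClosed (n := (⊤ : ℕ∞)) (𝓡 d) hA
    hU₀.isClosed_compl (disjoint_compl_right_iff_subset.2 hAU₀)
  obtain ⟨f₂, hf₂, hf₁₂⟩ := H.homotopicRel_cellMap collapseProfile norm_collapseProfile_le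
    collapseProfile_of_norm_eq_one contDiff_collapseProfile.continuous
    collapseProfile_zero f₁ (a := s) s.contMDiff.continuous hs0
  have hrc : Continuous fun m => H.radius (f₁ m) := H.continuous_radius.comp f₁.continuous
  let B₂ : Set M := U₂ ∪ {m | H.radius (f₁ m) < 3 / 4}
  have hB₂ : IsOpen B₂ := hU₂.union (isOpen_lt hrc continuous_const)
  have hf₁B₂ : ∀ m ∈ B₂, DSmoothAt d f₁ m := by
    rintro m (hm | hm)
    exacts [hf₁U m hm, hf₁ m hm]
  have hf₂B₂ : ∀ m ∈ B₂, DSmoothAt d f₂ m := fun m hm => by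
    have h1 := ((dSmoothAt_of_contMDiff s.contMDiff m).prodMk (hf₁B₂ m hm)).dSmooth_comp
      (H.dSmooth_cellMap collapseProfile norm_collapseProfile_le
        collapseProfile_of_norm_eq_one contDiff_collapseProfile)
    exact h1.congr (Eventually.of_forall fun m' => (hf₂ m').symm)
  let C : Set M := closure U₁ ∪ {m | H.radius (f₁ m) ≤ 7 / 10}
  have hC : IsClosed C := isClosed_closure.union (isClosed_le hrc continuous_const)
  have hCB₂ : C ⊆ B₂ := union_subset_union hU₁₂ fun m (hm : H.radius (f₁ m) ≤ 7 / 10) =>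
    (show H.radius (f₁ m) < 3 / 4 by linarith)
  let V : TopologicalSpace.Opens M :=
    ⟨(closure U₀)ᶜ ∩ {m | 1 / 2 < H.radius (f₁ m)},
      isClosed_closure.isOpen_compl.inter (isOpen_lt continuous_const hrc)⟩
  have hVr : ∀ m ∈ V, 0 < H.radius (f₁ m) := fun m hm =>
    lt_trans (by norm_num) (show 1 / 2 < H.radius (f₁ m) from hm.2)
  have hVC : ∀ m ∉ V, C ∈ 𝓝 m := by
    intro m hm
    by_cases hm0 : m ∈ closure U₀
    · exact mem_of_superset (hU₁.mem_nhds (hU₀₁ hm0)) fun x hx => Or.inl (subset_closure hx)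
    · have hm1 : H.radius (f₁ m) ≤ 1 / 2 := not_lt.1 fun h => hm ⟨hm0, h⟩
      have : {m | H.radius (f₁ m) < 7 / 10} ∈ 𝓝 m :=
        (isOpen_lt hrc continuous_const).mem_nhds
          (show H.radius (f₁ m) < 7 / 10 by linarith)
      exact mem_of_superset this fun x (hx : H.radius (f₁ x) < 7 / 10) => Or.inr hx.le
  -- on `V` the map `f₂` takes values in `L`
  have hrV : Continuous fun x : V => H.collar (f₁ x) :=
    H.continuousOn_collar.comp_continuous (by fun_prop) fun x => hVr x x.2
  have hf₂V : ∀ x : V, f₂ x = i (H.collar (f₁ x)) := fun x => by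
    have hsx : s x = 1 := hs1 fun hx => x.2.1 (subset_closure hx)
    have hx2 : 1 / 2 < H.radius (f₁ x) := x.2.2
    rw [hf₂, hsx]
    rcases H.cover (f₁ x) with ⟨l, hl⟩ | ⟨⟨c, y⟩, -, hy⟩
    · rw [← hl, H.cellMap_left, H.collar_left]
    · rw [← hy, H.radius_right] at hx2
      have hy0 : y.1 ≠ 0 := norm_pos_iff.1 (by linarith)
      rw [← hy, H.cellMap_right _ _ collapseProfile_of_norm_eq_one, H.collar_right, ← H.comm]
      refine congrArg (j c) (Subtype.ext ?_)
      exact (collapseProfile_one hx2.le).trans (toSph_coe hy0).symm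
  have : SigmaCompactSpace V := sigmaCompactSpace_opens d V
  obtain ⟨g, hg, hgh⟩ := hL V ⟨_, hrV⟩ (Subtype.val ⁻¹' C) (Subtype.val ⁻¹' B₂)
    (hC.preimage continuous_subtype_val) (hB₂.preimage continuous_subtype_val)
    (preimage_mono hCB₂) fun x hx => H.dSmoothAt_collar ((hf₁B₂ x hx).restrict V)
      (Eventually.of_forall fun y => hVr y y.2)
  let ic : C(L, P) := ⟨i, H.smooth_left.continuous'⟩
  have hgl : (restrictOpens f₂ V).HomotopicRel (ic.comp g) (Subtype.val ⁻¹' C) := by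
    have := hgh.comp_continuousMap ic
    convert this using 1
    ext x
    exact hf₂V x
  obtain ⟨g', hg', hg'V⟩ := exists_homotopicRel_smooth_glue f₂ (fun _ : Unit => V)
    (fun _ _ _ _ _ => rfl) (ContinuousMap.const M 1) C
    (fun _ => ⟨ic.comp g, fun m => (hg m).dSmooth_comp H.smooth_left, hgl⟩)
    (fun m hm => mem_of_superset (hVC m (hm ())) fun x hx => Or.inr hx)
  have hAC : A ⊆ C := fun m hm => Or.inl (subset_closure (hU₀₁ (subset_closure (hAU₀ hm))))
  have hA₂ : A ⊆ closure U₂ := hAU₀.trans <| subset_closure.trans <| hU₀₁.trans <|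
    subset_closure.trans <| hU₁₂.trans subset_closure
  refine ⟨g', fun m => ?_, (homotopicRel_mono hff₁ hA₂).trans
    (hf₁₂.trans (homotopicRel_mono hg' (hAC.trans subset_union_left)))⟩
  by_cases hm : m ∈ V
  · exact hg'V () m hm (Eventually.of_forall fun _ => rfl)
  · refine (hf₂B₂ m (hCB₂ (mem_of_mem_nhds (hVC m hm)))).congr ?_
    filter_upwards [hVC m hm] with m' hm' using hg'.fst_eq_snd (Or.inl hm')

/-! ### Discrete spaces -/

lemma eventually_eq_of_isPlot_bot {X : Type*} [e : DiffeologicalSpace X] (he : e = ⊥) {k : ℕ}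
    {p : Euc k → X} (hp : IsPlot p) (x : Euc k) : ∀ᶠ y in 𝓝 x, p y = p x := by
  let D : DiffeologicalSpace X := locallyGeneratedDiffeology
    (fun k => {q | ∃ x, q = fun _ => x}) (fun _ x => ⟨x, rfl⟩)
    (by rintro k m p e ⟨x, rfl⟩ -; exact ⟨x, rfl⟩)
  have hle : e ≤ D := he ▸ bot_le
  obtain ⟨q, ⟨z, rfl⟩, hz⟩ := DiffeologicalSpace.le_iff'.1 hle k p hp x
  filter_upwards [hz] with y hy
  rw [hy, hz.self_of_nhds]

lemma discreteTopology_of_eq_bot {X : Type*} [e : DiffeologicalSpace X] (he : e = ⊥)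
    [TopologicalSpace X] [IsDTopologyCompatible X] : DiscreteTopology X := by
  refine discreteTopology_iff_forall_isOpen.2 fun U => isOpen_iff_plots.2 fun k p hp =>
    isOpen_iff_mem_nhds.2 fun x hx => ?_
  filter_upwards [eventually_eq_of_isPlot_bot he hp x] with y hy
  rwa [mem_preimage, hy]

lemma Approximable.of_discreteTopology (d : ℕ) (X : Type*) [TopologicalSpace X]
    [DiffeologicalSpace X] [DiscreteTopology X] : Approximable.{v} d X := by
  intro M _ _ _ _ _ f A B _ _ _ _
  refine ⟨f, fun m => ?_, .refl f⟩
  have h1 : ∀ᶠ m' in 𝓝 m, f m' = f m :=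
    f.continuous.continuousAt.eventually ((isOpen_discrete {f m}).mem_nhds rfl)
  have h2 : DSmoothAt d (fun _ => f m) m :=
    dSmoothAt_of_isOpen isOpen_univ (mem_univ m) fun _ _ _ _ => isPlot_const
  exact h2.congr (h1.mono fun _ h => h.symm)

/-! ### Sequential colimits of cell attachments -/

section Sequence

variable {Y : ℕ → Type u} (s : ∀ n, Y n → Y (n + 1))

/-- The transition maps of a sequence. -/
def seqMap {m n : ℕ} (hmn : m ≤ n) : Y m → Y n := Nat.leRecOn hmn fun {k} => s k

lemma seqMap_self {m : ℕ} (y : Y m) : seqMap s le_rfl y = y := Nat.leRecOn_self y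

lemma seqMap_succ {m n : ℕ} (hmn : m ≤ n) (y : Y m) :
    seqMap s (hmn.trans n.le_succ) y = s n (seqMap s hmn y) := Nat.leRecOn_succ hmn y

lemma seqMap_succ_left {m n : ℕ} (hmn : m + 1 ≤ n) (y : Y m) :
    seqMap s hmn (s m y) = seqMap s (m.le_succ.trans hmn) y := by
  induction n, hmn using Nat.le_induction with
  | base => rw [seqMap_self, seqMap_succ s le_rfl, seqMap_self]
  | succ n hmn ih => rw [seqMap_succ s hmn, ih, ← seqMap_succ s (m.le_succ.trans hmn)]

/-- A property of maps that holds for identities and is stable under postcomposition with the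
`s n` holds for all transition maps. -/
lemma seqMap_induction {p : ∀ m n, (Y m → Y n) → Prop} (hid : ∀ m, p m m id)
    (hs : ∀ m n f, p m n f → p m (n + 1) (s n ∘ f)) {m n : ℕ} (hmn : m ≤ n) :
    p m n (seqMap s hmn) := by
  induction n, hmn using Nat.le_induction with
  | base =>
    have : seqMap s (le_refl m) = id := funext (seqMap_self s)
    rw [this]; exact hid m
  | succ n hmn ih =>
    have : seqMap s (hmn.trans n.le_succ) = s n ∘ seqMap s hmn := funext (seqMap_succ s hmn)
    rw [this]; exact hs _ _ _ ih

variable {s} [∀ n, DiffeologicalSpace (Y n)] {X : Type u} [DiffeologicalSpace X]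
  {ι : ∀ n, Y n → X}

lemma IsSmoothSeqColimit.existsUnique_fun (H : IsSmoothSeqColimit s ι) (Z : Type u)
    (a : ∀ n, Y n → Z) (ha : ∀ n, a (n + 1) ∘ s n = a n) :
    ∃! c : X → Z, ∀ n, c ∘ ι n = a n := by
  let _ : DiffeologicalSpace Z := indiscreteDiffeology Z
  have hall : ∀ {Y : Type u} [DiffeologicalSpace Y] (f : Y → Z), DSmooth f :=
    fun f _ _ _ => mem_univ _
  obtain ⟨c, ⟨-, hc⟩, huniq⟩ := H.existsUnique_desc Z a (fun _ => hall _) ha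
  exact ⟨c, hc, fun c' hc' => huniq c' ⟨hall _, hc'⟩⟩

lemma IsSmoothSeqColimit.cover (H : IsSmoothSeqColimit s ι) (x : X) : ∃ n y, ι n y = x := by
  obtain ⟨c, -, huniq⟩ :=
    H.existsUnique_fun (ULift Prop) (fun _ _ => ⟨True⟩) (fun _ => rfl)
  have h1 := huniq (fun _ => ⟨True⟩) fun _ => rfl
  have h2 := huniq (fun x => ⟨∃ n y, ι n y = x⟩) fun n => funext fun y => by
    simp only [Function.comp, ULift.up.injEq, eq_iff_iff, iff_true]
    exact ⟨n, y, rfl⟩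
  simpa using (congrFun (h1.trans h2.symm) x).symm

lemma IsSmoothSeqColimit.seqMap_apply (H : IsSmoothSeqColimit s ι) {m n : ℕ} (hmn : m ≤ n)
    (y : Y m) : ι n (seqMap s hmn y) = ι m y :=
  seqMap_induction s (p := fun m n f => ∀ y, ι n (f y) = ι m y) (fun _ _ => rfl)
    (fun _ n _ h y => (congrFun (H.comm n) _).trans (h y)) hmn y

lemma IsSmoothSeqColimit.injective (H : IsSmoothSeqColimit s ι)
    (hs : ∀ n, Function.Injective (s n)) (n : ℕ) : Function.Injective (ι n) := by
  intro y t hyt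
  -- the indicator function of `t`, extended to the whole sequence
  obtain ⟨c, hc, -⟩ := H.existsUnique_fun (ULift Prop)
    (fun m y => ⟨∃ (N : ℕ) (hm : m ≤ N) (hn : n ≤ N), seqMap s hm y = seqMap s hn t⟩) (by
      intro m
      funext y
      simp only [Function.comp, ULift.up.injEq, eq_iff_iff]
      constructor
      · rintro ⟨N, hm, hn, h⟩
        exact ⟨N, m.le_succ.trans hm, hn, by rw [← h, seqMap_succ_left]⟩
      · rintro ⟨N, hm, hn, h⟩
        refine ⟨N + 1, Nat.succ_le_succ hm, hn.trans N.le_succ, ?_⟩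
        rw [seqMap_succ_left, seqMap_succ s hm, seqMap_succ s hn, h])
  have hcy := congrFun (hc n) y
  have hct := congrFun (hc n) t
  simp only [Function.comp] at hcy hct
  rw [hyt, hct] at hcy
  obtain ⟨N, hm, hn, h⟩ := (ULift.up.inj hcy).mp ⟨n, le_rfl, le_rfl, trivial⟩
  exact seqMap_induction s (p := fun _ _ f => Function.Injective f)
    (fun _ => Function.injective_id) (fun _ n _ h => (hs n).comp h) hm h

lemma IsSmoothSeqColimit.lift (H : IsSmoothSeqColimit s ι) {k : ℕ} {p : Euc k → X} (hp : IsPlot p)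
    (x : Euc k) : ∃ n, ∃ l : Euc k → Y n, IsPlot l ∧ p =ᶠ[𝓝 x] fun y => ι n (l y) := by
  -- `X` with the diffeology of the maps that locally lift has the universal property as well
  have hdesc := @IsSmoothSeqColimit.existsUnique_desc _ _ _ _ _ _ H X
  have hfun := H.existsUnique_fun X ι H.comm
  have hcomm := H.comm
  let G : ∀ k, Set (Euc k → X) := fun k =>
    {p | ∃ n, ∃ l : Euc k → Y n, IsPlot l ∧ p = fun y => ι n (l y)}
  let X' : DiffeologicalSpace X := locallyGeneratedDiffeology G
    (fun k x => by
      obtain ⟨n, y, rfl⟩ := H.cover x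
      exact ⟨n, fun _ => y, isPlot_const, rfl⟩)
    (by
      rintro k m p e ⟨n, l, hl, rfl⟩ he
      exact ⟨n, l ∘ e, isPlot_reparam hl he, rfl⟩)
  have X'_isPlot : ∀ k (p : Euc k → X), @IsPlot X X' k p ↔ ∀ x, ∃ q ∈ G k, p =ᶠ[𝓝 x] q :=
    fun _ _ => Iff.rfl
  clear_value X'
  have hι : ∀ n, @DSmooth (Y n) X _ X' (ι n) := fun n k l hl => (X'_isPlot _ _).2 fun x =>
    ⟨_, ⟨n, l, hl, rfl⟩, EventuallyEq.rfl⟩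
  obtain ⟨c, ⟨hc, hcι⟩, -⟩ := @hdesc X' ι hι hcomm
  have hid : c = id := by
    obtain ⟨c', -, huniq⟩ := hfun
    rw [huniq c hcι, huniq id fun _ => rfl]
  subst hid
  obtain ⟨q, ⟨n, l, hl, rfl⟩, hq⟩ := (X'_isPlot _ _).1 (hc k p hp) x
  exact ⟨n, l, hl, hq⟩

variable {J : ℕ → Type*} {h : ∀ n, J n → Sph n → Y n} {j : ∀ n, J n → Disk n → Y (n + 1)}
  (C : ∀ n, IsCellExtension (h n) (s n) (j n))

include C in
lemma isPlot_of_seqMap_comp {m n : ℕ} (hmn : m ≤ n) {k : ℕ} {p : Euc k → Y m}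
    (hp : IsPlot fun y => seqMap s hmn (p y)) : IsPlot p :=
  seqMap_induction s (p := fun m _ f => ∀ p : Euc k → Y m, IsPlot (fun y => f (p y)) → IsPlot p)
    (fun _ _ hp => hp) (fun _ n _ hf p hp => hf p ((C n).isPlot_of_comp hp)) hmn p hp

include C in
lemma dSmooth_seqMap {m n : ℕ} (hmn : m ≤ n) : DSmooth (seqMap s hmn) :=
  seqMap_induction s (p := fun _ _ f => DSmooth f) (fun _ => dSmooth_id)
    (fun _ n _ hf => (C n).smooth_left.comp hf) hmn

variable (H : IsSmoothSeqColimit s ι)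

include C H in
/-- The inclusions of the stages of the colimit are inductions. -/
lemma IsSmoothSeqColimit.isPlot_of_comp (n : ℕ) {k : ℕ} {p : Euc k → Y n}
    (hp : IsPlot fun y => ι n (p y)) : IsPlot p := by
  have hinj := H.injective fun n => (C n).injective
  refine isPlot_of_forall_nhds fun x => ?_
  obtain ⟨m, l, hl, hpl⟩ := H.lift hp x
  refine ⟨_, hpl, fun e he heu => ?_⟩
  have heu' : ∀ y, ι n (p (e y)) = ι m (l (e y)) := heu
  have hl' : IsPlot (l ∘ e) := isPlot_reparam hl he
  rcases le_total m n with hmn | hmn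
  · have : p ∘ e = seqMap s hmn ∘ (l ∘ e) := funext fun y => hinj n <| by
      simp only [Function.comp, H.seqMap_apply, heu']
    rw [this]
    exact dSmooth_seqMap C hmn _ _ hl'
  · refine isPlot_of_seqMap_comp C hmn ?_
    have : (fun y => seqMap s hmn ((p ∘ e) y)) = l ∘ e := funext fun y => hinj m <| by
      simp only [Function.comp, H.seqMap_apply, heu']
    rw [this]
    exact hl'

variable [∀ n, TopologicalSpace (Y n)] [∀ n, IsDTopologyCompatible (Y n)] [TopologicalSpace X]
  [IsDTopologyCompatible X]

include H in
lemma IsSmoothSeqColimit.isClosed_of {T : Set X} (hT : ∀ n, IsClosed (ι n ⁻¹' T)) :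
    IsClosed T := by
  refine isOpen_compl_iff.1 (isOpen_iff_plots.2 fun k p hp => isOpen_iff_mem_nhds.2 fun x hx => ?_)
  obtain ⟨n, l, hl, hpl⟩ := H.lift hp x
  have hx' : x ∈ l ⁻¹' (ι n ⁻¹' T)ᶜ := by
    have := hpl.self_of_nhds
    simpa [this] using hx
  filter_upwards [hpl, ((hT n).isOpen_compl.preimage (continuous_of_isPlot hl)).mem_nhds hx']
    with y hy hyT
  simpa [hy] using hyT

include C H in
lemma IsSmoothSeqColimit.isClosedEmbedding (n : ℕ) : IsClosedEmbedding (ι n) := by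
  have hinj := H.injective fun n => (C n).injective
  refine .of_continuous_injective_isClosedMap (H.smooth n).continuous' (hinj n) fun T hT => ?_
  refine H.isClosed_of fun m => ?_
  rcases le_total m n with hmn | hmn
  · convert hT.preimage (dSmooth_seqMap C hmn).continuous' using 1
    ext y
    constructor
    · rintro ⟨t, ht, hty⟩
      rw [← H.seqMap_apply hmn] at hty
      rw [mem_preimage, ← hinj n hty]
      exact ht
    · exact fun hy => ⟨_, hy, H.seqMap_apply hmn y⟩
  · have hcl : IsClosedMap (seqMap s hmn) :=
      seqMap_induction s (p := fun _ _ f => IsClosedMap f) (fun _ => IsClosedMap.id)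
        (fun _ n _ hf => (C n).isClosedEmbedding.isClosedMap.comp hf) hmn
    convert hcl T hT using 1
    ext y
    constructor
    · rintro ⟨t, ht, hty⟩
      refine ⟨t, ht, hinj m ?_⟩
      rw [H.seqMap_apply, hty]
    · rintro ⟨t, ht, rfl⟩
      exact ⟨t, ht, (H.seqMap_apply hmn t).symm⟩

include C in
lemma t1Space_stage [T1Space (Y 0)] (n : ℕ) : T1Space (Y n) := by
  induction n with
  | zero => infer_instance
  | succ n ih => exact (C n).t1Space

include C H in
/-- Compact subsets of the colimit are contained in a stage. Otherwise there is a sequence in the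
compact set of points outside the successive stages, all of whose tails are closed. -/
lemma IsSmoothSeqColimit.exists_subset_range [T1Space (Y 0)] {Q : Set X} (hQ : IsCompact Q) :
    ∃ n, Q ⊆ range (ι n) := by
  have hinj := H.injective fun n => (C n).injective
  by_contra hcon
  push Not at hcon
  have hx : ∀ n, ∃ x ∈ Q, x ∉ range (ι n) := fun n => not_subset.1 (hcon n)
  choose x hxQ hxn using hx
  have hmono : ∀ {m n}, m ≤ n → range (ι m) ⊆ range (ι n) := by
    rintro m n hmn _ ⟨y, rfl⟩
    exact ⟨_, H.seqMap_apply hmn y⟩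
  have hclosed : ∀ k, IsClosed (x '' Ici k) := fun k => H.isClosed_of fun m => by
    have := t1Space_stage C m
    refine Set.Finite.isClosed ?_
    refine (((finite_lt_nat m).image x).preimage (hinj m).injOn).subset ?_
    rintro y ⟨i, -, hiy⟩
    refine ⟨i, ?_, hiy⟩
    by_contra him
    exact hxn i (hmono (not_lt.1 him) ⟨y, hiy.symm⟩)
  obtain ⟨z, hz⟩ := IsCompact.nonempty_iInter_of_sequence_nonempty_isCompact_isClosed
    (fun k => x '' Ici k) (fun k => image_mono (Ici_subset_Ici.2 k.le_succ))
    (fun k => ⟨x k, k, self_mem_Ici, rfl⟩)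
    (hQ.of_isClosed_subset (hclosed 0) (by rintro _ ⟨i, -, rfl⟩; exact hxQ i)) hclosed
  obtain ⟨m, y, rfl⟩ := H.cover z
  obtain ⟨i, hi, hiy⟩ := mem_iInter.1 hz m
  exact hxn i (hmono hi ⟨y, hiy.symm⟩)

include C H in
/-- Smooth approximation of maps with values in a stage of the colimit. -/
lemma IsSmoothSeqColimit.exists_homotopicRel_of_subset_range {d n : ℕ}
    (hY : Approximable.{v} d (Y n)) {M : Type v} [TopologicalSpace M] [T2Space M]
    [SigmaCompactSpace M] [ChartedSpace (EuclideanSpace ℝ (Fin d)) M] [IsManifold (𝓡 d) ∞ M]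
    (f : C(M, X)) (hf : range f ⊆ range (ι n)) {A B : Set M} (hA : IsClosed A) (hB : IsOpen B)
    (hAB : A ⊆ B) (hfB : ∀ m ∈ B, DSmoothAt d f m) :
    ∃ g : C(M, X), (∀ m, DSmoothAt d g m) ∧ f.HomotopicRel g A := by
  choose f' hf' using fun m => hf (mem_range_self m)
  have hc : Continuous f' := by
    rw [(H.isClosedEmbedding C n).isInducing.continuous_iff]
    exact f.continuous.congr fun m => (hf' m).symm
  have hs : ∀ m ∈ B, DSmoothAt d f' m := by
    intro m hm
    obtain ⟨U, hU, hmU, hp⟩ := hfB m hm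
    refine ⟨U, hU, hmU, fun k p hps hpU => H.isPlot_of_comp C n ?_⟩
    have := hp k p hps hpU
    rwa [show f ∘ p = fun y => ι n ((f' ∘ p) y) from funext fun y => (hf' _).symm] at this
  obtain ⟨g, hg, hfg⟩ := hY M ⟨f', hc⟩ A B hA hB hAB hs
  let c : C(Y n, X) := ⟨ι n, (H.smooth n).continuous'⟩
  refine ⟨c.comp g, fun m => (hg m).dSmooth_comp (H.smooth n), ?_⟩
  have := hfg.comp_continuousMap c
  rwa [show c.comp ⟨f', hc⟩ = f from ContinuousMap.ext hf'] at this

include C in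
lemma approximable_stage {d : ℕ} [DiscreteTopology (Y 0)] (n : ℕ) :
    Approximable.{v} d (Y n) := by
  induction n with
  | zero => exact .of_discreteTopology d _
  | succ n ih => exact .of_isCellExtension (C n) ih

include C H in
/-- The colimit of a sequence of cell attachments is approximable. Cut the source along the even,
respectively odd, levels of an exhaustion function into relatively compact pieces, whose images
lie in stages of the colimit; the map is made smooth on the first pieces up to a cutoff near the odd
levels, and then on the second pieces relative to a neighbourhood of the even levels. -/
theorem IsSmoothSeqColimit.approximable {d : ℕ} [DiscreteTopology (Y 0)] :
    Approximable.{v} d X := by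
  intro M _ _ _ _ _ f A B hA hB hAB hf
  have : NormalSpace M := normalSpace_of_chartedSpace d M
  have : LocallyCompactSpace M := ChartedSpace.locallyCompactSpace (EuclideanSpace ℝ (Fin d)) M
  obtain ⟨τ, hτ⟩ := exists_continuous_exhaustion M
  let w : M → ℝ := fun m => Real.cos (Real.pi * τ m)
  have hw : Continuous w := by fun_prop
  let W : ℝ → ℤ → TopologicalSpace.Opens M := fun a k =>
    ⟨{m | a + 2 * k < τ m} ∩ {m | τ m < a + 2 * k + 2},
      (isOpen_lt continuous_const τ.continuous).inter (isOpen_lt τ.continuous continuous_const)⟩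
  have hWd : ∀ a k l (m : M), m ∈ W a k → m ∈ W a l → k = l := by
    intro a k l m hk hl
    obtain ⟨hk1, hk2⟩ : a + 2 * k < τ m ∧ τ m < a + 2 * k + 2 := hk
    obtain ⟨hl1, hl2⟩ : a + 2 * l < τ m ∧ τ m < a + 2 * l + 2 := hl
    have h1 : (k : ℝ) < l + 1 := by linarith
    have h2 : (l : ℝ) < k + 1 := by linarith
    norm_cast at h1 h2
    omega
  -- the points outside the pieces
  have hWn : ∀ a (m : M), (∀ k, m ∉ W a k) → ∃ k : ℤ, τ m = a + 2 * k := by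
    intro a m hm
    refine ⟨⌊(τ m - a) / 2⌋, ?_⟩
    by_contra hne
    have h1 := Int.floor_le ((τ m - a) / 2)
    have h2 := Int.lt_floor_add_one ((τ m - a) / 2)
    refine hm ⌊(τ m - a) / 2⌋ ⟨lt_of_le_of_ne ?_ (Ne.symm hne), ?_⟩
    · linarith
    · change τ m < _
      linarith
  have hpiece : ∀ a k (f : C(M, X)) (A B : Set M), IsClosed A → IsOpen B → A ⊆ B →
      (∀ m ∈ B, DSmoothAt d f m) → ∃ g : C(W a k, X), (∀ m, DSmoothAt d g m) ∧
        (restrictOpens f (W a k)).HomotopicRel g (Subtype.val ⁻¹' A) := by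
    intro a k f A B hA hB hAB hf
    obtain ⟨Q, hQ, hQτ⟩ := hτ (a + 2 * k + 2)
    obtain ⟨n, hn⟩ := H.exists_subset_range C (hQ.image f.continuous)
    have : SigmaCompactSpace (W a k) := sigmaCompactSpace_opens d _
    refine H.exists_homotopicRel_of_subset_range C (approximable_stage C n)
      (restrictOpens f (W a k)) ?_ (hA.preimage continuous_subtype_val)
      (hB.preimage continuous_subtype_val) (preimage_mono hAB) fun m hm => (hf m hm).restrict _
    rintro _ ⟨m, rfl⟩
    exact hn ⟨m, hQτ (show τ m ≤ _ from (show τ m < _ from m.2.2).le), rfl⟩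
  obtain ⟨U, hU, hAU, hUB⟩ := normal_exists_closure_subset hA hB hAB
  -- smoothing away from the odd levels
  let c : C(M, unitInterval) :=
    ⟨fun m => projIcc 0 1 zero_le_one (2 * w m + 1), by fun_prop⟩
  obtain ⟨f₁, hff₁, hf₁⟩ := exists_homotopicRel_smooth_glue f (W (-1)) (hWd _) c (closure U)
    (fun k => hpiece _ k f _ _ isClosed_closure hB hUB hf) (by
      intro m hm
      obtain ⟨k, hk⟩ := hWn _ m hm
      have hwm : w m < -1 / 2 := by
        have : Real.pi * τ m = k * (2 * Real.pi) - Real.pi := by rw [hk]; ring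
        simp only [w, this, Real.cos_int_mul_two_pi_sub_pi]
        norm_num
      filter_upwards [hw.continuousAt.eventually_lt continuousAt_const hwm] with m' hm'
      exact Or.inl (projIcc_of_le_left zero_le_one (by linarith)))
  let B₁ : Set M := U ∪ {m | 0 < w m}
  have hf₁B : ∀ m ∈ B₁, DSmoothAt d f₁ m := by
    rintro m (hm | hm)
    · refine (hf m (hUB (subset_closure hm))).congr ?_
      filter_upwards [hU.mem_nhds hm] with m' hm'
        using hff₁.fst_eq_snd (Or.inl (subset_closure hm'))
    · have hmW : ∃ k, m ∈ W (-1) k := by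
        by_contra hcon
        push Not at hcon
        obtain ⟨k, hk⟩ := hWn _ m hcon
        have h1 : Real.pi * τ m = k * (2 * Real.pi) - Real.pi := by rw [hk]; ring
        have h2 : 0 < w m := hm
        simp only [w, h1, Real.cos_int_mul_two_pi_sub_pi] at h2
        linarith
      obtain ⟨k, hk⟩ := hmW
      refine hf₁ k m hk ?_
      filter_upwards [continuousAt_const.eventually_lt hw.continuousAt hm] with m' hm'
      exact projIcc_of_right_le zero_le_one (by linarith)
  -- smoothing away from the even levels
  let S : Set M := A ∪ {m | 1 / 2 ≤ w m}
  obtain ⟨g, hg, hgs⟩ := exists_homotopicRel_smooth_glue f₁ (W 0) (hWd _)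
    (ContinuousMap.const M 1) S
    (fun k => hpiece _ k f₁ S B₁ (hA.union (isClosed_le continuous_const hw))
      (hU.union (isOpen_lt continuous_const hw))
      (union_subset_union hAU fun m (hm : 1 / 2 ≤ w m) => show 0 < w m by linarith) hf₁B) (by
      intro m hm
      obtain ⟨k, hk⟩ := hWn _ m hm
      have hwm : 1 / 2 < w m := by
        have : Real.pi * τ m = k * (2 * Real.pi) := by rw [hk]; ring
        simp only [w, this, Real.cos_int_mul_two_pi]
        norm_num
      filter_upwards [continuousAt_const.eventually_lt hw.continuousAt hwm] with m' hm'
      exact Or.inr (Or.inr (le_of_lt hm')))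
  refine ⟨g, fun m => ?_,
    (homotopicRel_mono hff₁ fun m hm => Or.inl (subset_closure (hAU hm))).trans
      (homotopicRel_mono hg fun m hm => Or.inl (Or.inl hm))⟩
  by_cases hm : ∃ k, m ∈ W 0 k
  · obtain ⟨k, hk⟩ := hm
    exact hgs k m hk (Eventually.of_forall fun _ => rfl)
  · push Not at hm
    obtain ⟨k, hk⟩ := hWn _ m hm
    have hwm : 1 / 2 < w m := by
      have : Real.pi * τ m = k * (2 * Real.pi) := by rw [hk]; ring
      simp only [w, this, Real.cos_int_mul_two_pi]
      norm_num
    refine (hf₁B m (Or.inr (show 0 < w m by linarith))).congr ?_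
    filter_upwards [continuousAt_const.eventually_lt hw.continuousAt hwm] with m' hm'
    exact hg.fst_eq_snd (Or.inl (Or.inr (le_of_lt hm')))

end Sequence

/-! ### Smooth CW complexes and paracompact manifolds -/

/-- A smooth CW complex with its D-topology is approximable. -/
theorem SmoothCWStructure.approximable {X : Type*} [DiffeologicalSpace X]
    (K : SmoothCWStructure X) (d : ℕ) [TopologicalSpace X] [IsDTopologyCompatible X] :
    Approximable.{v} d X := by
  have := K.skelDiffeology
  let _ : ∀ n, TopologicalSpace (K.skel n) := fun n => @dTopology _ (K.skelDiffeology n)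
  have : ∀ n, @IsDTopologyCompatible (K.skel n) _ (K.skelDiffeology n) := fun n =>
    @IsDTopologyCompatible.mk _ _ (K.skelDiffeology n) rfl
  have : DiscreteTopology (K.skel 0) :=
    @discreteTopology_of_eq_bot _ (K.skelDiffeology 0) K.skel_zero_discrete _ (this 0)
  let _ := K.skelDiffeology
  exact IsSmoothSeqColimit.approximable
    (fun n => (K.isPushout n).isCellExtension (K.smooth_attach n)) K.isColimit

/-- Relative smooth approximation for maps from a paracompact manifold, obtained by treating its
connected components separately. -/
theorem Approximable.exists_homotopicRel {d : ℕ} {X : Type*} [TopologicalSpace X]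
    [DiffeologicalSpace X] (hX : Approximable.{v} d X) {M : Type v} [TopologicalSpace M]
    [T2Space M] [ParacompactSpace M] [ChartedSpace (EuclideanSpace ℝ (Fin d)) M]
    [IsManifold (𝓡 d) ∞ M] (f : C(M, X)) {A B : Set M} (hA : IsClosed A) (hB : IsOpen B)
    (hAB : A ⊆ B) (hf : ∀ m ∈ B, DSmoothAt d f m) :
    ∃ g : C(M, X), (∀ m, DSmoothAt d g m) ∧ f.HomotopicRel g A := by
  have : LocallyCompactSpace M := ChartedSpace.locallyCompactSpace (EuclideanSpace ℝ (Fin d)) M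
  have : LocallyConnectedSpace M :=
    ChartedSpace.locallyConnectedSpace (EuclideanSpace ℝ (Fin d)) M
  have hmk : ∀ m : M, (ConnectedComponents.mk ⁻¹' {ConnectedComponents.mk m} : Set M) =
      connectedComponent m := fun _ => connectedComponents_preimage_singleton
  let W : ConnectedComponents M → TopologicalSpace.Opens M := fun c =>
    ⟨ConnectedComponents.mk ⁻¹' {c}, by
      obtain ⟨m, rfl⟩ := ConnectedComponents.surjective_coe c
      rw [hmk]
      exact isOpen_connectedComponent⟩
  have hW : ∀ m, m ∈ W (ConnectedComponents.mk m) := fun m => rfl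
  obtain ⟨g, hfg, hg⟩ := exists_homotopicRel_smooth_glue f W
    (fun c c' m hc hc' => (mem_singleton_iff.1 hc).symm.trans (mem_singleton_iff.1 hc'))
    (ContinuousMap.const M 1) A
    (fun c => by
      have : SigmaCompactSpace (W c) := by
        obtain ⟨m, rfl⟩ := ConnectedComponents.surjective_coe c
        refine isSigmaCompact_iff_sigmaCompactSpace.1 ?_
        change IsSigmaCompact (ConnectedComponents.mk ⁻¹' {ConnectedComponents.mk m})
        rw [hmk]
        exact isSigmaCompact_connectedComponent m
      exact hX (W c) (restrictOpens f (W c)) _ _ (hA.preimage continuous_subtype_val)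
        (hB.preimage continuous_subtype_val) (preimage_mono hAB) fun m hm => (hf m hm).restrict _)
    (fun m hm => absurd (hW m) (hm _))
  exact ⟨g, fun m => hg _ m (hW m) (Eventually.of_forall fun _ => rfl),
    homotopicRel_mono hfg subset_union_left⟩

/-- A homotopy parametrised by the unit interval, reparametrised to be stationary for
`t ≤ 1/4` and `t ≥ 3/4`. -/
theorem exists_isContinuousHomotopy {d : ℕ} {M : Type*} [TopologicalSpace M]
    [ChartedSpace (EuclideanSpace ℝ (Fin d)) M] [IsManifold (𝓡 d) ∞ M] {X : Type*}
    [TopologicalSpace X] [DiffeologicalSpace X] [IsDTopologyCompatible X] {f g : C(M, X)}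
    {A : Set M} (hfg : f.HomotopicRel g A) :
    letI : DiffeologicalSpace M := manifoldDiffeology d M
    ∃ H : M × ℝ → X, IsContinuousHomotopy H f g ∧ IsRelativeTo H f A := by
  let _ : DiffeologicalSpace M := manifoldDiffeology d M
  obtain ⟨F⟩ := hfg
  let H : M × ℝ → X := fun y => F (projIcc 0 1 zero_le_one (2 * y.2 - 1 / 2), y.1)
  have hH : Continuous H := by fun_prop
  refine ⟨H, ⟨?_, 1 / 4, by norm_num, by norm_num, fun m t ht => ?_, fun m t ht => ?_⟩,
    fun m hm t => ?_⟩
  · -- the D-topology of `M × ℝ` is at least as fine as the product topology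
    refine continuous_def.2 fun U hU => isOpen_iff_preimages_plots.2 fun k p hp => ?_
    rw [IsDTopologyCompatible.dTop_eq X] at hU
    have h1 : ContMDiff (𝓡 k) (𝓡 d) ∞ fun y => (p y).1 := hp.1
    have h2 : Continuous p := h1.continuous.prodMk hp.2.contDiff.continuous
    exact hU.preimage (hH.comp h2)
  · simp only [H]
    rw [projIcc_of_le_left zero_le_one (by linarith)]
    exact F.apply_zero m
  · simp only [H]
    rw [projIcc_of_right_le zero_le_one (by linarith)]
    exact F.apply_one m
  · exact F.eq_fst _ hm

end WhitneyCW

end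

open WhitneyCW
theorem theorem2p2 {d : ℕ} {M : Type*} [TopologicalSpace M] [T2Space M] [ParacompactSpace M]
    [ChartedSpace (EuclideanSpace ℝ (Fin d)) M] [IsManifold (𝓡 d) ∞ M]
    {X : Type*} [DiffeologicalSpace X] (K : SmoothCWStructure X) :
    letI : DiffeologicalSpace M := manifoldDiffeology d M
    ∀ f : M → X, DContinuous f →
      (∃ (g : M → X) (H : M × ℝ → X), DSmooth g ∧ IsContinuousHomotopy H f g) ∧
      (∀ A : Set M, IsClosed A → SmoothOnNhd f A → (CompactSpace M ∨ K.IsFiniteDimensional) →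
        ∃ (g : M → X) (H : M × ℝ → X),
          DSmooth g ∧ IsContinuousHomotopy H f g ∧ IsRelativeTo H f A) := by
  let _ : DiffeologicalSpace M := manifoldDiffeology d M
  intro f hf
  let _ : TopologicalSpace X := dTopology
  have : IsDTopologyCompatible X := ⟨rfl⟩
  let f' : C(M, X) := ⟨f, hf⟩
  have key : ∀ A : Set M, IsClosed A → SmoothOnNhd f A → ∃ (g : M → X) (H : M × ℝ → X),
      DSmooth g ∧ IsContinuousHomotopy H f g ∧ IsRelativeTo H f A := by
    rintro A hA ⟨B, hB, hAB, hfB⟩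
    -- the D-topology of `M` is by definition its given topology
    have hB' : IsOpen B := hB
    obtain ⟨g, hg, hfg⟩ := (K.approximable d).exists_homotopicRel f' hA hB' hAB
      fun m hm => dSmoothAt_of_isOpen hB' hm fun k p hp hpB => hfB k (fun y => ⟨p y, hpB y⟩) hp
    obtain ⟨H, hH, hHA⟩ := exists_isContinuousHomotopy (d := d) hfg
    exact ⟨g, H, fun k p hp => DSmoothAt.isPlot_comp hp fun x => hg _, hH, hHA⟩
  refine ⟨?_, fun A hA hfA _ => key A hA hfA⟩
  -- the absolute case is the case of the empty set
  obtain ⟨g, H, hg, hH, -⟩ := key ∅ isClosed_empty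
    ⟨∅, @isOpen_empty _ dTopology, subset_rfl, fun k p _ => (p 0).2.elim⟩
  exact ⟨g, H, hg, hH⟩
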